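/- **Theorem (oracle property of the generalized outcome-adaptive lasso, GOAL).** Let $(x_i,a_i,y_i)_{i\ge 1}$ be i.i.d. copies of $(X,A,Y)$, with covariates $X=(X_1,\dots,X_p)^T\in\mathbb R^p$ ($p$ fixed), $E X_j^2<\infty$, a binary treatment $A\in\{0,1\}$ and an outcome $Y\in\mathbb R$. Assume the logistic propensity score model $\operatorname{logit}P(A=1\mid X)=X^T\alpha^0$, and write $Y=\beta_A^*A+X^T\beta^*+\varepsilon$, where $E(\varepsilon A)=0$, $E(\varepsilon X_j)=0$, $E(\varepsilon^2A^2)<\infty$ and $E(\varepsilon^2X_j^2)<\infty$ for all $j$. Let $$\mathcal C=\{j:\alpha^0_j\ne0,\ \beta^*_j\neq0\},\quad \mathcal P=\{j:\alpha^0_j=0,\ \beta^*_j\neq0\},\quad \mathcal I=\{j:\alpha^0_j\ne0,\ \beta^*_j=0\},\quad \mathcal S=\{j:\alpha^0_j=0,\ \beta^*_j=0\}$$ be the sets of confounders, pure predictors of the outcome, pure predictors of the treatment, and spurious covariates, and let $\mathcal A=\mathcal C\cup\mathcal P$. Let $\alpha^*\in\mathbb R^p$, with $\alpha^*_j=0$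 for $j\notin\mathcal A$, be the parameter of the parsimonious propensity score, which is assumed to be logistic as well: $$\operatorname{logit}P(A=1\mid X_{\mathcal A})=\sum_{j\in\mathcal A}\alpha^*_jX_j .$$ Let $\phi(t)=\log(1+e^t)$, let $\mathbf F(\alpha^*)=E\big(\phi''(X^T\alpha^*)XX^T\big)$ be the Fisher information matrix, and let $\mathbf F_{11}$ be its block with rows and columns in $\mathcal A$ (the Fisher information of the parsimonious propensity score). Let $\lambda_1=\lambda_{1,n}\ge0$, $\lambda_2=\lambda_{2,n}\ge0$ and $\gamma$ be tuning parameters and let $$\hat\alpha\in\arg\min_{\alpha\in\mathbb R^p}\Big[\sum_{i=1}^n\{-a_ix_i^T\alpha+\phi(x_i^T\alpha)\}+\lambda_1\sum_{j=1}^p\hat w_j|\alpha_j|+\lambda_2\sum_{j=1}^p\alpha_j^2\Big],\qquad \hat w_j=|\hat\beta_j|^{-\gamma},$$ where $(\hat\beta_A,\hat\beta)$ minimizes $\sum_{i=1}^n(y_i-\beta_Aa_i-x_i^T\beta)^2$ (with $\hat w_j=\infty$ if $\hat\beta_j=0$, and $\infty\cdot0=0$). Assume: 1. $\mathbf F(\alpha^*)$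 is finite and positive definite. 2. There are functions $M_1,M_2$ on $\mathbb R^p$ such that, for all $\alpha$ in a neighborhood of $\alpha^*$ and all $x$, $|\phi''(x^T\alpha)|\le M_1(x)$ and $|\phi'''(x^T\alpha)|\le M_2(x)$, with $E\,M_1(X)<\infty$ and $E\big(M_2(X)|X_jX_kX_l|\big)<\infty$ for all $j,k,l\in\mathcal A$. 3. $\gamma>1$, $\lambda_1/\sqrt n\to0$ and $\lambda_1n^{\gamma/2-1}\to\infty$. 4. $\lambda_2/\sqrt n\to0$. Then: 1. (Consistency in variable selection) $\lim_{n\to\infty}P\{\hat\alpha_j=0\text{ for all }j\in\mathcal I\cup\mathcal S\}=1$. 2. (Asymptotic normality) $\sqrt n(\hat\alpha_{\mathcal A}-\alpha^*_{\mathcal A})\to_d N(0,\mathbf F_{11}^{-1})$. -/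

import Mathlib

open MeasureTheory ProbabilityTheory Filter Topology Matrix
open scoped ENNReal

noncomputable section

namespace GOAL

variable {p : ℕ}

/-- The function `φ(t) = log (1 + e ^ t)` of the logistic model. -/
def phi (t : ℝ) : ℝ := Real.log (1 + Real.exp t)

/-- Negative logistic log-likelihood of the first `n` observations. -/
def negLogLik (n : ℕ) (x : ℕ → Fin p → ℝ) (a : ℕ → ℝ) (α : Fin p → ℝ) : ℝ :=
  ∑ i ∈ Finset.range n, (-(a i * (x i ⬝ᵥ α)) + phi (x i ⬝ᵥ α))

/-- `(bA, b)` minimises `‖Y - c_A A - X c‖²` over all `(c_A, c)`, for the first `n` observations. -/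
def IsOLS (n : ℕ) (x : ℕ → Fin p → ℝ) (a y : ℕ → ℝ) (bA : ℝ) (b : Fin p → ℝ) : Prop :=
  ∀ (cA : ℝ) (c : Fin p → ℝ),
    ∑ i ∈ Finset.range n, (y i - bA * a i - x i ⬝ᵥ b) ^ 2 ≤
      ∑ i ∈ Finset.range n, (y i - cA * a i - x i ⬝ᵥ c) ^ 2

/-- The adaptive weight `|b| ^ (-γ)`; it is `∞` if `b = 0` (and `γ > 0`). -/
def weight (γ b : ℝ) : ℝ≥0∞ := ENNReal.ofReal |b| ^ (-γ)

/-- The penalised criterion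
`ℓ_n(α) + lam1 * ∑ j, w_j * |α_j| + lam2 * ∑ j, α_j ^ 2` with `w_j = |b_j| ^ (-γ)`.
It takes values in the extended reals because a weight may be infinite; `∞ * 0 = 0`. -/
def objective (n : ℕ) (x : ℕ → Fin p → ℝ) (a : ℕ → ℝ) (lam1 lam2 γ : ℝ) (b α : Fin p → ℝ) :
    EReal :=
  ((negLogLik n x a α + lam2 * ∑ j, α j ^ 2 : ℝ) : EReal) +
    ((ENNReal.ofReal lam1 * ∑ j, weight γ (b j) * ENNReal.ofReal |α j| : ℝ≥0∞) : EReal)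

/-- `α` is a global minimiser of the GOAL criterion with preliminary estimates `b`. -/
def IsGOAL (n : ℕ) (x : ℕ → Fin p → ℝ) (a : ℕ → ℝ) (lam1 lam2 γ : ℝ) (b α : Fin p → ℝ) : Prop :=
  ∀ α' : Fin p → ℝ, objective n x a lam1 lam2 γ b α ≤ objective n x a lam1 lam2 γ b α'

/-! Types of covariates: `α j ≠ 0` means that covariate `j` is related to the treatment
(`α` the coefficients of the propensity score given all covariates), `β j ≠ 0` that it is
related to the outcome (`β` the coefficients of the covariates in the outcome regression). -/

open Classical in
/-- Covariates related to both treatment and outcome. -/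
def confounders (α β : Fin p → ℝ) : Finset (Fin p) :=
  Finset.univ.filter fun j => α j ≠ 0 ∧ β j ≠ 0

open Classical in
/-- Pure predictors of the outcome. -/
def outcomeOnly (α β : Fin p → ℝ) : Finset (Fin p) :=
  Finset.univ.filter fun j => α j = 0 ∧ β j ≠ 0

open Classical in
/-- Pure predictors of the treatment. -/
def treatmentOnly (α β : Fin p → ℝ) : Finset (Fin p) :=
  Finset.univ.filter fun j => α j ≠ 0 ∧ β j = 0

open Classical in
/-- Spurious covariates, related neither to the treatment nor to the outcome. -/
def spurious (α β : Fin p → ℝ) : Finset (Fin p) :=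
  Finset.univ.filter fun j => α j = 0 ∧ β j = 0

/-- The covariates to include: confounders and pure predictors of the outcome. -/
def desirable (α β : Fin p → ℝ) : Finset (Fin p) := confounders α β ∪ outcomeOnly α β

/-- The Fisher information matrix `E (φ''(xᵀα) x xᵀ)`, for a random vector `x`. -/
def fisherInfo {Ω : Type*} [MeasurableSpace Ω] (P : Measure Ω) (x : Ω → Fin p → ℝ)
    (α : Fin p → ℝ) : Matrix (Fin p) (Fin p) ℝ :=
  Matrix.of fun j k => ∫ ω, iteratedDeriv 2 phi (x ω ⬝ᵥ α) * (x ω j * x ω k) ∂P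

/-- The block of a square matrix with rows and columns in `s` (for `s = {1, …, p₀}`, `F₁₁`). -/
def block (s : Finset (Fin p)) (F : Matrix (Fin p) (Fin p) ℝ) : Matrix s s ℝ :=
  F.submatrix Subtype.val Subtype.val

end GOAL

end

/-! Least squares is root-n consistent (`boundedInProb_sqrt_mul_ols`): the population Gram matrix of
(A, X) is positive definite, since a positive definite Fisher information excludes collinear
covariates and a propensity score strictly between 0 and 1 keeps A from being a function of X. With
high probability, λ₁ŵ_j is therefore of larger order than n when β_j = 0, whereas ŵ_j stays bounded
when β_j ≠ 0.

Selection is a global comparison that needs no prior rate for α̂. The logistic loss is 1-Lipschitz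
in the linear predictor, so replacing α̂_j by 0 raises the negative log-likelihood by at most |α̂_j|
Σ_i |x_ij| = O_P(n)|α̂_j|, while it saves λ₁ŵ_j|α̂_j| (`IsGOAL.eq_zero_of_sum_lt_weight`,
`eventually_lt_mul_weight`).

Once the coefficients outside 𝒜 vanish, α̂_𝒜 minimises a convex penalised logistic criterion in the
covariates of 𝒜. Write θ = α*_𝒜. Between θ and θ + u/√n the penalty changes by o_P(1), uniformly for
bounded u, because λ₁/√n and λ₂/√n tend to 0; the likelihood term changes by uᵀMu/2 − Vᵀu + o_P(1),
with V the normalised score and M = F₁₁ (`IsIID.logistic_expansion`). The quadratic is minimised at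
M⁻¹V, and convexity transfers this to √n(α̂_𝒜 − θ) = M⁻¹V + o_P(1)
(`IsIID.penalized_logistic_asymptotically_linear`). The parsimonious propensity score being
correctly specified, V is centred with covariance M, so M⁻¹V tends to N(0, M⁻¹) by the central limit
theorem, and Slutsky's lemma concludes. -/

namespace GOAL

/-! ### The logistic loss: Lipschitz and Taylor bounds. -/

section Logistic

lemma hasDerivAt_phi (t : ℝ) : HasDerivAt phi (Real.sigmoid t) t := by
  have h : HasDerivAt (fun t => Real.log (1 + Real.exp t)) (Real.exp t / (1 + Real.exp t)) t :=
    ((Real.hasDerivAt_exp t).const_add 1).log (by positivity)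
  refine h.congr_deriv ?_
  rw [Real.sigmoid_def, Real.exp_neg]
  have := Real.exp_pos t
  field_simp
  ring

lemma deriv_phi : deriv phi = Real.sigmoid := funext fun t => (hasDerivAt_phi t).deriv

lemma iteratedDeriv_two_phi (t : ℝ) :
    iteratedDeriv 2 phi t = Real.sigmoid t * (1 - Real.sigmoid t) := by
  rw [iteratedDeriv_succ, iteratedDeriv_one, deriv_phi, Real.deriv_sigmoid]

lemma continuous_phi : Continuous phi :=
  continuous_iff_continuousAt.2 fun t => (hasDerivAt_phi t).continuousAt

lemma convexOn_phi : ConvexOn ℝ Set.univ phi := by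
  refine MonotoneOn.convexOn_of_deriv convex_univ continuous_phi.continuousOn
    (fun t _ => (hasDerivAt_phi t).differentiableAt.differentiableWithinAt) ?_
  rw [deriv_phi]
  exact Real.sigmoid_monotone.monotoneOn _

/-- The slope -a + σ lies in [-1, 1] because a is 0 or 1. This global bound is what the adaptive
weight has to beat when a coefficient is set to zero. -/
lemma abs_logistic_loss_sub_le {a : ℝ} (ha : a = 0 ∨ a = 1) (s t : ℝ) :
    |(-(a * s) + phi s) - (-(a * t) + phi t)| ≤ |s - t| := by
  have key := Convex.norm_image_sub_le_of_norm_hasDerivWithin_le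
    (f := fun s => -(a * s) + phi s) (f' := fun s => -a + Real.sigmoid s) (C := 1)
    (s := Set.univ) (x := t) (y := s)
    (fun r _ => by
      have h := ((hasDerivAt_id r).const_mul a).neg.add (hasDerivAt_phi r)
      exact (h.congr_deriv (by simp)).hasDerivWithinAt)
    (fun r _ => by
      have h0 := Real.sigmoid_nonneg r
      have h1 := Real.sigmoid_le_one r
      rw [Real.norm_eq_abs, abs_le]
      rcases ha with rfl | rfl <;> constructor <;> linarith)
    convex_univ (Set.mem_univ _) (Set.mem_univ _)
  simpa [Real.norm_eq_abs] using key

/-- Both φ'' and φ''' = σ(1 - σ)(1 - 2σ) are bounded by 1 in absolute value. Keeping the truncation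
at 1 is what later makes second moments of the covariates suffice. -/
lemma abs_sigmoid_mul_one_sub_sub_le (s t : ℝ) :
    |Real.sigmoid s * (1 - Real.sigmoid s) - Real.sigmoid t * (1 - Real.sigmoid t)|
      ≤ min 1 |s - t| := by
  have hb : ∀ r, 0 ≤ Real.sigmoid r * (1 - Real.sigmoid r) ∧
      Real.sigmoid r * (1 - Real.sigmoid r) ≤ 1 := fun r => by
    have h0 := Real.sigmoid_nonneg r
    have h1 := Real.sigmoid_le_one r
    constructor <;> nlinarith
  refine le_min ?_ ?_
  · rw [abs_le]
    constructor <;> linarith [(hb s).1, (hb s).2, (hb t).1, (hb t).2]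
  · have key := Convex.norm_image_sub_le_of_norm_hasDerivWithin_le
      (f := fun r => Real.sigmoid r * (1 - Real.sigmoid r))
      (f' := fun r => Real.sigmoid r * (1 - Real.sigmoid r) * (1 - Real.sigmoid r) +
        Real.sigmoid r * (-(Real.sigmoid r * (1 - Real.sigmoid r)))) (C := 1)
      (s := Set.univ) (x := t) (y := s)
      (fun r _ => ((Real.hasDerivAt_sigmoid r).mul
        ((Real.hasDerivAt_sigmoid r).const_sub 1)).hasDerivWithinAt)
      (fun r _ => by
        have h0 := Real.sigmoid_nonneg r
        have h1 := Real.sigmoid_le_one r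
        have h2 : Real.sigmoid r * (1 - Real.sigmoid r) * (1 - Real.sigmoid r) +
          Real.sigmoid r * (-(Real.sigmoid r * (1 - Real.sigmoid r)))
          = Real.sigmoid r * (1 - Real.sigmoid r) * (1 - 2 * Real.sigmoid r) := by ring
        rw [h2, Real.norm_eq_abs, abs_mul, abs_of_nonneg (hb r).1]
        refine mul_le_one₀ (hb r).2 (abs_nonneg _) ?_
        rw [abs_le]
        constructor <;> linarith)
      convex_univ (Set.mem_univ _) (Set.mem_univ _)
    simpa [Real.norm_eq_abs] using key

/-- Mean value inequality on |r| ≤ |s|, where the derivative of the error, φ''(t + r) - φ''(t), is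
at most `min 1 |s|`. A second integration of the same kind gives the quadratic bound for `phi`. -/
lemma abs_sigmoid_sub_linear_le (t s : ℝ) :
    |Real.sigmoid (t + s) - Real.sigmoid t - Real.sigmoid t * (1 - Real.sigmoid t) * s|
      ≤ min 1 |s| * |s| := by
  set v := Real.sigmoid t * (1 - Real.sigmoid t)
  have key := Convex.norm_image_sub_le_of_norm_hasDerivWithin_le
    (f := fun r => Real.sigmoid (t + r) - Real.sigmoid t - v * r)
    (f' := fun r => Real.sigmoid (t + r) * (1 - Real.sigmoid (t + r)) - v) (C := min 1 |s|)
    (s := Metric.closedBall 0 |s|) (x := 0) (y := s)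
    (fun r _ => by
      have h1 := (Real.hasDerivAt_sigmoid (t + r)).comp_const_add t r
      have h := (h1.sub_const (Real.sigmoid t)).sub ((hasDerivAt_id r).const_mul v)
      exact (h.congr_deriv (by simp [v])).hasDerivWithinAt)
    (fun r hr => by
      have hr' : |r| ≤ |s| := by simpa using hr
      refine (abs_sigmoid_mul_one_sub_sub_le (t + r) t).trans ?_
      rw [add_sub_cancel_left]
      exact min_le_min_left _ hr')
    (convex_closedBall _ _) (by simp) (by simp)
  simpa [Real.norm_eq_abs] using key

lemma abs_phi_sub_quadratic_le (t s : ℝ) :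
    |phi (t + s) - phi t - Real.sigmoid t * s -
      Real.sigmoid t * (1 - Real.sigmoid t) * s ^ 2 / 2| ≤ min 1 |s| * s ^ 2 := by
  set v := Real.sigmoid t * (1 - Real.sigmoid t) with hv
  have key := Convex.norm_image_sub_le_of_norm_hasDerivWithin_le
    (f := fun r => phi (t + r) - phi t - Real.sigmoid t * r - v * r ^ 2 / 2)
    (f' := fun r => Real.sigmoid (t + r) - Real.sigmoid t - v * r) (C := min 1 |s| * |s|)
    (s := Metric.closedBall 0 |s|) (x := 0) (y := s)
    (fun r _ => by
      have h1 := (hasDerivAt_phi (t + r)).comp_const_add t r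
      have h := ((h1.sub_const (phi t)).sub ((hasDerivAt_id r).const_mul (Real.sigmoid t))).sub
        ((((hasDerivAt_id r).pow 2).const_mul v).div_const 2)
      refine (h.congr_deriv ?_).hasDerivWithinAt
      simp
      ring)
    (fun r hr => by
      have hr' : |r| ≤ |s| := by simpa using hr
      refine (abs_sigmoid_sub_linear_le t r).trans ?_
      gcongr)
    (convex_closedBall _ _) (by simp) (by simp)
  rw [Real.norm_eq_abs, Real.norm_eq_abs, sub_zero, mul_assoc (min 1 |s|),
    abs_mul_abs_self, ← sq] at key
  simpa using key

end Logistic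

/-! ### Convex minimisers and quadratic forms, in the sup norm. -/

section Deterministic

/-- A convex function that is larger on a sphere than at its centre has all its minimisers
inside the sphere. -/
lemma norm_sub_lt_of_convexOn_of_sphere_lt {E : Type*} [NormedAddCommGroup E] [NormedSpace ℝ E]
    {g : E → ℝ} (hg : ConvexOn ℝ Set.univ g) {u₀ u : E} {δ : ℝ} (hδ : 0 < δ)
    (hsphere : ∀ v, ‖v - u₀‖ = δ → g u₀ < g v) (hu : g u ≤ g u₀) : ‖u - u₀‖ < δ := by
  by_contra! h
  have hpos : 0 < ‖u - u₀‖ := hδ.trans_le h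
  set t := δ / ‖u - u₀‖
  have ht0 : 0 ≤ t := by positivity
  have ht1 : t ≤ 1 := (div_le_one hpos).2 h
  have h1 := hg.2 (Set.mem_univ u₀) (Set.mem_univ u) (sub_nonneg.2 ht1) ht0 (by ring)
  have h2 : g u₀ < g ((1 - t) • u₀ + t • u) := by
    apply hsphere
    have : (1 - t) • u₀ + t • u - u₀ = t • (u - u₀) := by module
    rw [this, norm_smul, Real.norm_of_nonneg ht0, div_mul_cancel₀ _ hpos.ne']
  simp only [smul_eq_mul] at h1
  nlinarith

variable {ι : Type*} [Fintype ι]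

lemma abs_dotProduct_le (x u : ι → ℝ) : |x ⬝ᵥ u| ≤ (∑ j, |x j|) * ‖u‖ := by
  rw [dotProduct, Finset.sum_mul]
  refine (Finset.abs_sum_le_sum_abs _ _).trans (Finset.sum_le_sum fun j _ => ?_)
  rw [abs_mul]
  exact mul_le_mul_of_nonneg_left (norm_le_pi_norm u j) (abs_nonneg _)

lemma abs_quadratic_form_le {M : Matrix ι ι ℝ} {η : ℝ} (hM : ∀ j k, |M j k| ≤ η) (u : ι → ℝ) :
    |u ⬝ᵥ M *ᵥ u| ≤ (Fintype.card ι) ^ 2 * η * ‖u‖ ^ 2 := by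
  have h1 : ∀ j, |(M *ᵥ u) j| ≤ Fintype.card ι * η * ‖u‖ := fun j => by
    refine (abs_dotProduct_le _ _).trans ?_
    refine mul_le_mul_of_nonneg_right ?_ (norm_nonneg _)
    refine (Finset.sum_le_sum fun k _ => hM j k).trans ?_
    simp
  rw [dotProduct_comm]
  refine (abs_dotProduct_le _ _).trans ?_
  calc (∑ j, |(M *ᵥ u) j|) * ‖u‖ ≤ (∑ _j : ι, Fintype.card ι * η * ‖u‖) * ‖u‖ := by
        gcongr with j _
        exact h1 j
    _ = _ := by simp; ring

/-- A positive definite quadratic form is bounded below by a multiple of the squared norm. -/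
lemma exists_le_quadratic_form {M : Matrix ι ι ℝ} (hM : ∀ u : ι → ℝ, u ≠ 0 → 0 < u ⬝ᵥ M *ᵥ u) :
    ∃ c > 0, ∀ u : ι → ℝ, c * ‖u‖ ^ 2 ≤ u ⬝ᵥ M *ᵥ u := by
  have hcont : Continuous fun u : ι → ℝ => u ⬝ᵥ M *ᵥ u := by
    unfold dotProduct mulVec dotProduct
    fun_prop
  have hq : ∀ u ∈ Metric.sphere (0 : ι → ℝ) 1, 0 < u ⬝ᵥ M *ᵥ u := fun u hu => hM u <| by
    rintro rfl
    simp at hu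
  -- This form of compactness does not ask for a nonempty sphere, so an empty index type is allowed.
  obtain ⟨c, hc, hle⟩ := (isCompact_sphere (0 : ι → ℝ) 1).exists_forall_le' hcont.continuousOn hq
  refine ⟨c, hc, fun u => ?_⟩
  rcases eq_or_ne u 0 with rfl | hu
  · simp
  have hn : 0 < ‖u‖ := norm_pos_iff.2 hu
  have h := hle (‖u‖⁻¹ • u) (by simp [norm_smul, hn.ne'])
  rw [mulVec_smul, dotProduct_smul, smul_dotProduct, smul_eq_mul, smul_eq_mul] at h
  calc c * ‖u‖ ^ 2 ≤ ‖u‖⁻¹ * (‖u‖⁻¹ * (u ⬝ᵥ M *ᵥ u)) * ‖u‖ ^ 2 := by gcongr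
    _ = _ := by field_simp

end Deterministic

end GOAL

namespace GOAL

/-! ### Calculus of likely events and of boundedness in probability. -/

section HighProbability

variable {Ω : Type*} [MeasurableSpace Ω] {P : Measure Ω}

/-- The property `q n` holds with (outer) probability tending to one. -/
def WithHighProb (P : Measure Ω) (q : ℕ → Ω → Prop) : Prop :=
  Tendsto (fun n => P {ω | ¬ q n ω}) atTop (𝓝 0)

/-- A sequence of random variables is bounded in probability. -/
def BoundedInProb (P : Measure Ω) (f : ℕ → Ω → ℝ) : Prop :=
  ∀ η : ℝ≥0∞, 0 < η → ∃ K : ℝ, ∀ᶠ n in atTop, P {ω | ¬ |f n ω| ≤ K} ≤ η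

lemma WithHighProb.mono_ae {q r : ℕ → Ω → Prop} (hq : WithHighProb P q)
    (h : ∀ᶠ n in atTop, ∀ᵐ ω ∂P, q n ω → r n ω) : WithHighProb P r := by
  refine tendsto_of_tendsto_of_tendsto_of_le_of_le' tendsto_const_nhds hq
    (Eventually.of_forall fun _ => zero_le) ?_
  filter_upwards [h] with n hn
  refine measure_mono_ae ?_
  filter_upwards [hn] with ω hω
  exact mt hω

lemma WithHighProb.mono {q r : ℕ → Ω → Prop} (hq : WithHighProb P q)
    (h : ∀ᶠ n in atTop, ∀ ω, q n ω → r n ω) : WithHighProb P r :=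
  hq.mono_ae (h.mono fun _ hn => Eventually.of_forall hn)

lemma WithHighProb.of_ae {q : ℕ → Ω → Prop} (h : ∀ᶠ n in atTop, ∀ᵐ ω ∂P, q n ω) :
    WithHighProb P q :=
  WithHighProb.mono_ae (q := fun _ _ => True) (by simp [WithHighProb])
    (h.mono fun _ hn => hn.mono fun _ hω _ => hω)

lemma WithHighProb.and {q r : ℕ → Ω → Prop} (hq : WithHighProb P q) (hr : WithHighProb P r) :
    WithHighProb P fun n ω => q n ω ∧ r n ω := by
  have h := Tendsto.add hq hr
  rw [add_zero] at h
  refine tendsto_of_tendsto_of_tendsto_of_le_of_le tendsto_const_nhds h (fun _ => zero_le)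
    fun n => ?_
  refine (measure_mono fun ω hω => ?_).trans (measure_union_le _ _)
  simpa only [Set.mem_union, Set.mem_ofPred_eq, not_and_or] using hω

lemma WithHighProb.forall {κ : Type*} [Finite κ] {q : κ → ℕ → Ω → Prop}
    (hq : ∀ k, WithHighProb P (q k)) : WithHighProb P fun n ω => ∀ k, q k n ω := by
  have := Fintype.ofFinite κ
  have h := tendsto_finsetSum Finset.univ fun k _ => hq k
  rw [Finset.sum_const_zero] at h
  refine tendsto_of_tendsto_of_tendsto_of_le_of_le tendsto_const_nhds h (fun _ => zero_le)
    fun n => ?_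
  refine (measure_mono fun ω hω => ?_).trans (measure_biUnion_finset_le _ _)
  simpa using hω

/-- Permits arguing as if a tight sequence were bounded by a fixed constant: the exceptional event
costs at most η/2, and K is chosen from η. -/
lemma BoundedInProb.withHighProb {f : ℕ → Ω → ℝ} (hf : BoundedInProb P f) {q : ℕ → Ω → Prop}
    (h : ∀ K : ℝ, WithHighProb P fun n ω => |f n ω| ≤ K → q n ω) : WithHighProb P q := by
  refine ENNReal.tendsto_nhds_zero.2 fun η hη => ?_
  obtain ⟨K, hK⟩ := hf (η / 2) (ENNReal.half_pos hη.ne')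
  filter_upwards [hK, ENNReal.tendsto_nhds_zero.1 (h K) (η / 2) (ENNReal.half_pos hη.ne')]
    with n h1 h2
  calc P {ω | ¬ q n ω} ≤ P ({ω | ¬ |f n ω| ≤ K} ∪ {ω | ¬ (|f n ω| ≤ K → q n ω)}) := by
        refine measure_mono fun ω hω => ?_
        by_cases hc : |f n ω| ≤ K
        · right
          exact fun h => hω (h hc)
        · left
          exact hc
    _ ≤ η / 2 + η / 2 := (measure_union_le _ _).trans (add_le_add h1 h2)
    _ = η := ENNReal.add_halves η

lemma BoundedInProb.of_abs_le {f g : ℕ → Ω → ℝ} {C : ℝ} (hf : BoundedInProb P f) (hC : 0 ≤ C)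
    (h : WithHighProb P fun n ω => |g n ω| ≤ C * |f n ω|) : BoundedInProb P g := by
  intro η hη
  obtain ⟨K, hK⟩ := hf (η / 2) (ENNReal.half_pos hη.ne')
  refine ⟨C * K, ?_⟩
  filter_upwards [hK, ENNReal.tendsto_nhds_zero.1 h (η / 2) (ENNReal.half_pos hη.ne')]
    with n h1 h2
  calc P {ω | ¬ |g n ω| ≤ C * K}
      ≤ P ({ω | ¬ |f n ω| ≤ K} ∪ {ω | ¬ |g n ω| ≤ C * |f n ω|}) := by
        refine measure_mono fun ω hω => ?_
        by_contra hc
        simp only [Set.mem_union, Set.mem_ofPred_eq, not_or, not_not] at hc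
        exact hω (hc.2.trans (mul_le_mul_of_nonneg_left hc.1 hC))
    _ ≤ η / 2 + η / 2 := (measure_union_le _ _).trans (add_le_add h1 h2)
    _ = η := ENNReal.add_halves η

lemma BoundedInProb.abs_add {f g : ℕ → Ω → ℝ} (hf : BoundedInProb P f) (hg : BoundedInProb P g) :
    BoundedInProb P fun n ω => |f n ω| + |g n ω| := by
  intro η hη
  obtain ⟨K, hK⟩ := hf (η / 2) (ENNReal.half_pos hη.ne')
  obtain ⟨L, hL⟩ := hg (η / 2) (ENNReal.half_pos hη.ne')
  refine ⟨K + L, ?_⟩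
  filter_upwards [hK, hL] with n h1 h2
  calc P {ω | ¬ |(|f n ω| + |g n ω|)| ≤ K + L}
      ≤ P ({ω | ¬ |f n ω| ≤ K} ∪ {ω | ¬ |g n ω| ≤ L}) := by
        refine measure_mono fun ω hω => ?_
        by_contra hc
        simp only [Set.mem_union, Set.mem_ofPred_eq, not_or, not_not] at hc
        refine hω ?_
        rw [abs_of_nonneg (by positivity)]
        exact add_le_add hc.1 hc.2
    _ ≤ η / 2 + η / 2 := (measure_union_le _ _).trans (add_le_add h1 h2)
    _ = η := ENNReal.add_halves η

lemma BoundedInProb.sum_abs {κ : Type*} (s : Finset κ) {f : κ → ℕ → Ω → ℝ}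
    (hf : ∀ k, BoundedInProb P (f k)) : BoundedInProb P fun n ω => ∑ k ∈ s, |f k n ω| := by
  classical
  induction s using Finset.induction_on with
  | empty => exact fun η _ => ⟨0, by simp⟩
  | insert k s hk ih =>
    simp only [Finset.sum_insert hk]
    convert (hf k).abs_add ih using 5 with n ω
    rw [abs_of_nonneg (Finset.sum_nonneg fun _ _ => abs_nonneg _)]

/-- Markov's inequality for a sequence with expectations tending to zero. -/
lemma WithHighProb.le_of_integral_tendsto_zero [IsFiniteMeasure P] {f : ℕ → Ω → ℝ}
    (hf0 : ∀ n ω, 0 ≤ f n ω) (hf : ∀ n, Integrable (f n) P)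
    (h : Tendsto (fun n => ∫ ω, f n ω ∂P) atTop (𝓝 0)) {η : ℝ} (hη : 0 < η) :
    WithHighProb P fun n ω => f n ω ≤ η := by
  have h1 : Tendsto (fun n => ENNReal.ofReal ((∫ ω, f n ω ∂P) / η)) atTop (𝓝 0) := by
    have := ENNReal.tendsto_ofReal (h.div_const η)
    simpa using this
  refine tendsto_of_tendsto_of_tendsto_of_le_of_le tendsto_const_nhds h1 (fun _ => zero_le)
    fun n => ?_
  have h2 := mul_meas_ge_le_integral_of_nonneg (Eventually.of_forall (hf0 n)) (hf n) η
  calc P {ω | ¬ f n ω ≤ η} ≤ P {ω | η ≤ f n ω} := measure_mono fun ω hω => (not_le.1 hω).le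
    _ = ENNReal.ofReal (P.real {ω | η ≤ f n ω}) := (ofReal_measureReal).symm
    _ ≤ _ := ENNReal.ofReal_le_ofReal ((le_div_iff₀' hη).2 h2)

/-- Markov's inequality for a sequence with bounded expectations. -/
lemma BoundedInProb.of_integral_le [IsFiniteMeasure P] {f g : ℕ → Ω → ℝ} {C : ℝ}
    (hf0 : ∀ n ω, 0 ≤ f n ω) (hf : ∀ n, Integrable (f n) P) (h : ∀ n, ∫ ω, f n ω ∂P ≤ C)
    (hg : ∀ n ω, |g n ω| ≤ f n ω + 1) : BoundedInProb P g := by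
  intro η hη
  obtain ⟨K, hK0, hK⟩ : ∃ K : ℝ, 0 < K ∧ ENNReal.ofReal (C / K) ≤ η := by
    have h1 : Tendsto (fun K : ℝ => ENNReal.ofReal (C / K)) atTop (𝓝 0) := by
      have := ENNReal.tendsto_ofReal ((tendsto_id (α := ℝ)).const_div_atTop C)
      simpa using this
    exact ((eventually_gt_atTop 0).and (ENNReal.tendsto_nhds_zero.1 h1 η hη)).exists
  -- The slack 1 in `hg` lets the same lemma cover second moments, through |g| ≤ g² + 1.
  refine ⟨K + 1, Eventually.of_forall fun n => ?_⟩
  have h2 := mul_meas_ge_le_integral_of_nonneg (Eventually.of_forall (hf0 n)) (hf n) K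
  calc P {ω | ¬ |g n ω| ≤ K + 1} ≤ P {ω | K ≤ f n ω} := measure_mono fun ω hω => by
        have := hg n ω
        simp only [Set.mem_ofPred_eq, not_le] at hω ⊢
        linarith
    _ = ENNReal.ofReal (P.real {ω | K ≤ f n ω}) := (ofReal_measureReal).symm
    _ ≤ ENNReal.ofReal (C / K) :=
        ENNReal.ofReal_le_ofReal ((le_div_iff₀' hK0).2 (h2.trans (h n)))
    _ ≤ η := hK

end HighProbability

/-! ### Averages and normalised sums of i.i.d. variables. -/

section IID

variable {Ω : Type*} [MeasurableSpace Ω] {P : Measure Ω} {𝒲 : Type*} [MeasurableSpace 𝒲]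

/-- A sequence of independent random elements with a common law. -/
structure IsIID (P : Measure Ω) (W : ℕ → Ω → 𝒲) : Prop where
  indep : iIndepFun W P
  ident : ∀ i, IdentDistrib (W i) (W 0) P P

variable {W : ℕ → Ω → 𝒲}

lemma IsIID.comp (hW : IsIID P W) {f : 𝒲 → ℝ} (hf : Measurable f) :
    IsIID P fun i ω => f (W i ω) where
  indep := hW.indep.comp (fun _ => f) fun _ => hf
  ident i := (hW.ident i).comp hf

lemma IsIID.integrable_iff (hW : IsIID P W) {f : 𝒲 → ℝ} (hf : Measurable f) (i : ℕ) :
    Integrable (fun ω => f (W i ω)) P ↔ Integrable (fun ω => f (W 0 ω)) P :=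
  ((hW.comp hf).ident i).integrable_iff

lemma IsIID.integral_eq (hW : IsIID P W) {f : 𝒲 → ℝ} (hf : Measurable f) (i : ℕ) :
    ∫ ω, f (W i ω) ∂P = ∫ ω, f (W 0 ω) ∂P :=
  ((hW.comp hf).ident i).integral_eq

lemma IsIID.integral_sum (hW : IsIID P W) {f : 𝒲 → ℝ} (hf : Measurable f)
    (hint : Integrable (fun ω => f (W 0 ω)) P) (n : ℕ) :
    ∫ ω, ∑ i ∈ Finset.range n, f (W i ω) ∂P = n * ∫ ω, f (W 0 ω) ∂P := by
  rw [integral_finsetSum _ fun i _ => (hW.integrable_iff hf i).2 hint]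
  simp [hW.integral_eq hf]

variable [IsProbabilityMeasure P]

lemma IsIID.weak_law (hW : IsIID P W) {f : 𝒲 → ℝ} (hf : Measurable f)
    (hint : Integrable (fun ω => f (W 0 ω)) P) {η : ℝ} (hη : 0 < η) :
    WithHighProb P fun n ω =>
      |(n : ℝ)⁻¹ * ∑ i ∈ Finset.range n, f (W i ω) - ∫ ω, f (W 0 ω) ∂P| ≤ η := by
  have hiid := hW.comp hf
  have h := strong_law_ae_real (fun i ω => f (W i ω)) hint
    (fun i j hij => hiid.indep.indepFun hij) hiid.ident
  have hm : ∀ i, AEMeasurable (fun ω => f (W i ω)) P := fun i => (hiid.ident i).aemeasurable_fst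
  have h2 := tendstoInMeasure_of_tendsto_ae (μ := P)
    (f := fun n ω => (∑ i ∈ Finset.range n, f (W i ω)) / n) (g := fun _ => ∫ ω, f (W 0 ω) ∂P)
    (fun n => ((Finset.aemeasurable_fun_sum _ fun i _ => hm i).div_const _).aestronglyMeasurable) h
  have h3 := h2 (ENNReal.ofReal η) (by simpa using hη)
  refine tendsto_of_tendsto_of_tendsto_of_le_of_le tendsto_const_nhds h3 (fun _ => zero_le)
    fun n => measure_mono fun ω hω => ?_
  simp only [Set.mem_ofPred_eq, not_le] at hω ⊢
  rw [edist_dist, Real.dist_eq]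
  refine ENNReal.ofReal_le_ofReal ?_
  rw [div_eq_inv_mul]
  exact hω.le

lemma IsIID.boundedInProb_average (hW : IsIID P W) {f : 𝒲 → ℝ} (hf : Measurable f)
    (hint : Integrable (fun ω => f (W 0 ω)) P) (hf0 : ∀ w, 0 ≤ f w) :
    BoundedInProb P fun n ω => (n : ℝ)⁻¹ * ∑ i ∈ Finset.range n, f (W i ω) := by
  have h0 : ∀ (n : ℕ) (ω : Ω), 0 ≤ (n : ℝ)⁻¹ * ∑ i ∈ Finset.range n, f (W i ω) := fun n ω =>
    mul_nonneg (by positivity) (Finset.sum_nonneg fun i _ => hf0 _)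
  refine BoundedInProb.of_integral_le (C := ∫ ω, f (W 0 ω) ∂P) h0 (fun n => ?_) (fun n => ?_)
    fun n ω => ?_
  · exact (integrable_finsetSum _ fun i _ => (hW.integrable_iff hf i).2 hint).const_mul _
  · rw [integral_const_mul, hW.integral_sum hf hint, ← mul_assoc]
    refine mul_le_of_le_one_left (integral_nonneg fun ω => hf0 _) ?_
    -- Only an inequality: for n = 0 the factor n⁻¹ * n is 0.
    exact inv_mul_le_one
  · rw [abs_of_nonneg (h0 n ω)]
    linarith

/-- Normalised sums of centred square-integrable variables are bounded in probability. -/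
lemma IsIID.boundedInProb_normalized_sum (hW : IsIID P W) {f : 𝒲 → ℝ} (hf : Measurable f)
    (hL2 : MemLp (fun ω => f (W 0 ω)) 2 P) (hmean : ∫ ω, f (W 0 ω) ∂P = 0) :
    BoundedInProb P fun n ω => (Real.sqrt n)⁻¹ * ∑ i ∈ Finset.range n, f (W i ω) := by
  have hiid := hW.comp hf
  have hL : ∀ i, MemLp (fun ω => f (W i ω)) 2 P := fun i => (hiid.ident i).memLp_iff.2 hL2
  have hsum : ∀ n, MemLp (fun ω => ∑ i ∈ Finset.range n, f (W i ω)) 2 P := fun n =>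
    memLp_finsetSum _ fun i _ => hL i
  refine BoundedInProb.of_integral_le (C := Var[fun ω => f (W 0 ω); P])
    (f := fun n ω => (n : ℝ)⁻¹ * (∑ i ∈ Finset.range n, f (W i ω)) ^ 2)
    (fun n ω => by positivity) (fun n => (hsum n).integrable_sq.const_mul _) (fun n => ?_)
    fun n ω => ?_
  · have hmean' : ∫ ω, ∑ i ∈ Finset.range n, f (W i ω) ∂P = 0 := by
      rw [hW.integral_sum hf (hL2.integrable one_le_two), hmean, mul_zero]
    have hvar : ∫ ω, (∑ i ∈ Finset.range n, f (W i ω)) ^ 2 ∂P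
        = n * Var[fun ω => f (W 0 ω); P] := by
      rw [← variance_of_integral_eq_zero (hsum n).aestronglyMeasurable.aemeasurable hmean']
      have h := IndepFun.variance_sum (μ := P) (X := fun i ω => f (W i ω)) (s := Finset.range n)
        (fun i _ => hL i) (fun i _ j _ hij => hiid.indep.indepFun hij)
      have h2 : (∑ i ∈ Finset.range n, fun ω => f (W i ω))
          = fun ω => ∑ i ∈ Finset.range n, f (W i ω) := by
        ext ω
        simp
      rw [h2] at h
      rw [h, Finset.sum_congr rfl fun i _ => (hiid.ident i).variance_eq]
      simp
    rw [integral_const_mul, hvar, ← mul_assoc]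
    exact mul_le_of_le_one_left (variance_nonneg _ _) inv_mul_le_one
  · set T := ∑ i ∈ Finset.range n, f (W i ω)
    have h : (n : ℝ)⁻¹ * T ^ 2 = |(Real.sqrt n)⁻¹ * T| ^ 2 := by
      rw [sq_abs, mul_pow, inv_pow, Real.sq_sqrt (Nat.cast_nonneg n)]
    rw [h]
    nlinarith [sq_nonneg (|(Real.sqrt n)⁻¹ * T| - 1)]

end IID

end GOAL

/-! ### Empirical Gram forms and root-n consistency of least squares. -/

namespace GOAL

variable {Ω : Type*} [MeasurableSpace Ω] {P : Measure Ω} {𝒲 : Type*} [MeasurableSpace 𝒲]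
  {W : ℕ → Ω → 𝒲} {ι : Type*} [Fintype ι]

lemma measurable_dotProduct_const {z : 𝒲 → ι → ℝ} (hz : Measurable z) (u : ι → ℝ) :
    Measurable fun w => z w ⬝ᵥ u := by
  unfold dotProduct
  fun_prop

lemma mul_dotProduct_sq (w : ℝ) (z u : ι → ℝ) :
    w * (z ⬝ᵥ u) ^ 2 = ∑ j, u j * ∑ k, w * (z j * z k) * u k := by
  rw [dotProduct, sq, Finset.sum_mul_sum, Finset.mul_sum]
  refine Finset.sum_congr rfl fun j _ => ?_
  rw [Finset.mul_sum, Finset.mul_sum]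
  exact Finset.sum_congr rfl fun k _ => by ring

lemma integral_mul_dotProduct_sq {w : Ω → ℝ} {z : Ω → ι → ℝ}
    (hint : ∀ j k, Integrable (fun ω => w ω * (z ω j * z ω k)) P) (u : ι → ℝ) :
    ∫ ω, w ω * (z ω ⬝ᵥ u) ^ 2 ∂P =
      u ⬝ᵥ (Matrix.of fun j k => ∫ ω, w ω * (z ω j * z ω k) ∂P) *ᵥ u := by
  simp only [mul_dotProduct_sq]
  rw [integral_finsetSum _ fun j _ =>
    (integrable_finsetSum _ fun k _ => (hint j k).mul_const _).const_mul _]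
  refine Finset.sum_congr rfl fun j _ => ?_
  rw [integral_const_mul, integral_finsetSum _ fun k _ => (hint j k).mul_const _]
  simp [mulVec, dotProduct, integral_mul_const]

lemma integrable_mul_dotProduct_sq {w : Ω → ℝ} {z : Ω → ι → ℝ}
    (hint : ∀ j k, Integrable (fun ω => w ω * (z ω j * z ω k)) P) (u : ι → ℝ) :
    Integrable (fun ω => w ω * (z ω ⬝ᵥ u) ^ 2) P := by
  simp only [mul_dotProduct_sq]
  exact integrable_finsetSum _ fun j _ =>
    (integrable_finsetSum _ fun k _ => (hint j k).mul_const _).const_mul _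

lemma average_mul_dotProduct_sq (n : ℕ) (w : ℕ → ℝ) (z : ℕ → ι → ℝ) (u : ι → ℝ) :
    (n : ℝ)⁻¹ * ∑ i ∈ Finset.range n, w i * (z i ⬝ᵥ u) ^ 2 =
      u ⬝ᵥ (Matrix.of fun j k => (n : ℝ)⁻¹ * ∑ i ∈ Finset.range n, w i * (z i j * z i k)) *ᵥ u := by
  simp only [mul_dotProduct_sq]
  simp only [mulVec, dotProduct, Matrix.of_apply]
  rw [Finset.sum_comm, Finset.mul_sum]
  refine Finset.sum_congr rfl fun j _ => ?_
  rw [← Finset.mul_sum, Finset.sum_comm, mul_left_comm, Finset.mul_sum]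
  congr 1
  refine Finset.sum_congr rfl fun k _ => ?_
  rw [← Finset.sum_mul, mul_assoc]

variable [IsProbabilityMeasure P]

/-- Weak law of large numbers for weighted Gram forms, uniformly over bounded sets. -/
lemma IsIID.quadratic_form_weak_law (hW : IsIID P W) {w : 𝒲 → ℝ} (hw : Measurable w)
    {z : 𝒲 → ι → ℝ} (hz : Measurable z)
    (hint : ∀ j k, Integrable (fun ω => w (W 0 ω) * (z (W 0 ω) j * z (W 0 ω) k)) P)
    {η : ℝ} (hη : 0 < η) :
    WithHighProb P fun n ω => ∀ u : ι → ℝ,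
      |(n : ℝ)⁻¹ * ∑ i ∈ Finset.range n, w (W i ω) * (z (W i ω) ⬝ᵥ u) ^ 2 -
        ∫ ω, w (W 0 ω) * (z (W 0 ω) ⬝ᵥ u) ^ 2 ∂P| ≤ η * ‖u‖ ^ 2 := by
  -- Entrywise errors are multiplied by card² in the quadratic form; the added 1 keeps the
  -- denominator positive for an empty index type.
  have hη' : 0 < η / ((Fintype.card ι : ℝ) ^ 2 + 1) := by positivity
  have h := WithHighProb.forall fun j => WithHighProb.forall fun k =>
    hW.weak_law (f := fun v => w v * (z v j * z v k)) (by fun_prop) (hint j k) hη'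
  refine h.mono (Eventually.of_forall fun n ω hω u => ?_)
  rw [integral_mul_dotProduct_sq hint, average_mul_dotProduct_sq n (fun i => w (W i ω))
    (fun i => z (W i ω)), ← dotProduct_sub, ← sub_mulVec]
  refine (abs_quadratic_form_le (η := η / ((Fintype.card ι : ℝ) ^ 2 + 1)) hω u).trans ?_
  refine mul_le_mul_of_nonneg_right ?_ (by positivity)
  rw [mul_div_assoc', div_le_iff₀ (by positivity)]
  nlinarith

/-- Error bound for least squares: `d` is the estimation error, `e` the regression errors. -/
lemma sqrt_mul_norm_le_of_leastSquares {n : ℕ} (hn : 0 < n) {z : ℕ → ι → ℝ} {e : ℕ → ℝ}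
    {d : ι → ℝ} {c : ℝ} (hc : 0 < c)
    (hGram : c * ‖d‖ ^ 2 ≤ (n : ℝ)⁻¹ * ∑ i ∈ Finset.range n, (z i ⬝ᵥ d) ^ 2)
    (hmin : ∑ i ∈ Finset.range n, (e i - z i ⬝ᵥ d) ^ 2 ≤ ∑ i ∈ Finset.range n, e i ^ 2) :
    Real.sqrt n * ‖d‖ ≤
      2 / c * ∑ j, |(Real.sqrt n)⁻¹ * ∑ i ∈ Finset.range n, e i * z i j| := by
  have hn' : (0 : ℝ) < n := Nat.cast_pos.2 hn
  have hs : 0 < Real.sqrt n := Real.sqrt_pos.2 hn'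
  have hss : Real.sqrt n * Real.sqrt n = n := Real.mul_self_sqrt hn'.le
  set T : ι → ℝ := fun j => ∑ i ∈ Finset.range n, e i * z i j with hT
  -- Basic inequality: after expanding the squares in `hmin` the terms e² cancel.
  have h1 : ∑ i ∈ Finset.range n, (z i ⬝ᵥ d) ^ 2 ≤ 2 * (T ⬝ᵥ d) := by
    have h2 : T ⬝ᵥ d = ∑ i ∈ Finset.range n, e i * (z i ⬝ᵥ d) := by
      simp only [hT, dotProduct, Finset.sum_mul, Finset.mul_sum]
      rw [Finset.sum_comm]
      simp only [mul_assoc]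
    have h3 : ∑ i ∈ Finset.range n, (e i - z i ⬝ᵥ d) ^ 2 =
        ∑ i ∈ Finset.range n, e i ^ 2 - 2 * (T ⬝ᵥ d) +
          ∑ i ∈ Finset.range n, (z i ⬝ᵥ d) ^ 2 := by
      rw [h2, Finset.mul_sum, ← Finset.sum_sub_distrib, ← Finset.sum_add_distrib]
      exact Finset.sum_congr rfl fun i _ => by ring
    linarith
  have h4 : T ⬝ᵥ d ≤ (∑ j, |T j|) * ‖d‖ := (le_abs_self _).trans (abs_dotProduct_le _ _)
  have h5 : ∑ j, |(Real.sqrt n)⁻¹ * T j| = (Real.sqrt n)⁻¹ * ∑ j, |T j| := by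
    rw [Finset.mul_sum]
    exact Finset.sum_congr rfl fun j _ => by rw [abs_mul, abs_of_pos (inv_pos.2 hs)]
  rw [h5]
  rcases (norm_nonneg d).eq_or_lt with h0 | h0
  · rw [← h0, mul_zero]
    have := Finset.sum_nonneg fun (j : ι) (_ : j ∈ Finset.univ) => abs_nonneg (T j)
    positivity
  have h6 : c * ‖d‖ ^ 2 * n ≤ 2 * ((∑ j, |T j|) * ‖d‖) := by
    rw [inv_mul_eq_div, le_div_iff₀ hn'] at hGram
    linarith
  have h7 : c * ‖d‖ * n ≤ 2 * ∑ j, |T j| := by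
    refine le_of_mul_le_mul_right ?_ h0
    nlinarith
  rw [div_mul_eq_mul_div, le_div_iff₀ hc]
  refine le_of_mul_le_mul_right ?_ hs
  calc Real.sqrt n * ‖d‖ * c * Real.sqrt n = c * ‖d‖ * (Real.sqrt n * Real.sqrt n) := by ring
    _ = c * ‖d‖ * n := by rw [hss]
    _ ≤ 2 * ∑ j, |T j| := h7
    _ = _ := by field_simp

/-- Root-`n` consistency of least squares. -/
lemma IsIID.boundedInProb_leastSquares (hW : IsIID P W) {z : 𝒲 → ι → ℝ} (hz : Measurable z)
    {e : 𝒲 → ℝ} (he : Measurable e) (hz2 : ∀ j, MemLp (fun ω => z (W 0 ω) j) 2 P)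
    (hez2 : ∀ j, MemLp (fun ω => e (W 0 ω) * z (W 0 ω) j) 2 P)
    (hez : ∀ j, ∫ ω, e (W 0 ω) * z (W 0 ω) j ∂P = 0)
    (hpos : ∀ u : ι → ℝ, u ≠ 0 → 0 < ∫ ω, (z (W 0 ω) ⬝ᵥ u) ^ 2 ∂P)
    {d : ℕ → Ω → ι → ℝ}
    (hmin : ∀ n ω, ∑ i ∈ Finset.range n, (e (W i ω) - z (W i ω) ⬝ᵥ d n ω) ^ 2 ≤
      ∑ i ∈ Finset.range n, e (W i ω) ^ 2) :
    BoundedInProb P fun n ω => Real.sqrt n * ‖d n ω‖ := by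
  have hint : ∀ j k, Integrable (fun ω => (1 : ℝ) * (z (W 0 ω) j * z (W 0 ω) k)) P := fun j k => by
    simpa using! (hz2 j).integrable_mul (hz2 k)
  obtain ⟨c, hc, hle⟩ := exists_le_quadratic_form fun u hu => by
    rw [← integral_mul_dotProduct_sq hint u]
    simpa using hpos u hu
  -- An error of c/2 leaves the empirical Gram form at least (c/2)‖u‖². Uniformity in u is
  -- essential, as it is applied to the random error `d n ω`.
  have hG := hW.quadratic_form_weak_law (w := fun _ => 1) measurable_const hz hint (half_pos hc)
  have hT : BoundedInProb P fun n ω =>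
      ∑ j, |(Real.sqrt n)⁻¹ * ∑ i ∈ Finset.range n, e (W i ω) * z (W i ω) j| :=
    BoundedInProb.sum_abs _ fun j =>
      hW.boundedInProb_normalized_sum (f := fun v => e v * z v j) (by fun_prop) (hez2 j) (hez j)
  refine hT.of_abs_le (C := 2 / (c / 2)) (by positivity) (hG.mono ?_)
  filter_upwards [eventually_gt_atTop 0] with n hn ω hω
  rw [abs_of_nonneg (by positivity), abs_of_nonneg (Finset.sum_nonneg fun _ _ => abs_nonneg _)]
  refine sqrt_mul_norm_le_of_leastSquares hn (z := fun i => z (W i ω)) (e := fun i => e (W i ω))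
    (half_pos hc) ?_ (hmin n ω)
  have h1 := (abs_le.1 (hω (d n ω))).1
  have h2 := hle (d n ω)
  rw [← integral_mul_dotProduct_sq hint] at h2
  simp only [one_mul] at h1 h2
  linarith

end GOAL

/-! ### Local quadratic expansion of the logistic likelihood and its penalised minimisers. -/

namespace GOAL

variable {Ω : Type*} [MeasurableSpace Ω] {P : Measure Ω} {𝒲 : Type*} [MeasurableSpace 𝒲]
  {W : ℕ → Ω → 𝒲} {ι : Type*} [Fintype ι]

/-- Logistic loss of the linear predictor `t` for the response `a`. -/
noncomputable def logisticLoss (a t : ℝ) : ℝ := -(a * t) + phi t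

/-- Normalised score of the logistic model at `θ`. -/
noncomputable def normalizedScore (W : ℕ → Ω → 𝒲) (x : 𝒲 → ι → ℝ) (a : 𝒲 → ℝ) (θ : ι → ℝ)
    (n : ℕ) (ω : Ω) : ι → ℝ :=
  fun j => (Real.sqrt n)⁻¹ *
    ∑ i ∈ Finset.range n, (a (W i ω) - Real.sigmoid (x (W i ω) ⬝ᵥ θ)) * x (W i ω) j

/-- The logistic Fisher information. -/
noncomputable def logisticInfo (P : Measure Ω) (x : Ω → ι → ℝ) (θ : ι → ℝ) : Matrix ι ι ℝ :=
  Matrix.of fun j k => ∫ ω, Real.sigmoid (x ω ⬝ᵥ θ) * (1 - Real.sigmoid (x ω ⬝ᵥ θ)) *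
    (x ω j * x ω k) ∂P

lemma convexOn_sum_logisticLoss (s : Finset ℕ) (x : ℕ → ι → ℝ) (a : ℕ → ℝ) :
    ConvexOn ℝ Set.univ fun θ : ι → ℝ => ∑ i ∈ s, logisticLoss (a i) (x i ⬝ᵥ θ) := by
  refine ⟨convex_univ, fun u _ v _ r t hr ht hrt => ?_⟩
  simp only [smul_eq_mul, Finset.mul_sum, ← Finset.sum_add_distrib]
  refine Finset.sum_le_sum fun i _ => ?_
  have h := convexOn_phi.2 (Set.mem_univ (x i ⬝ᵥ u)) (Set.mem_univ (x i ⬝ᵥ v)) hr ht hrt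
  simp only [smul_eq_mul] at h
  simp only [logisticLoss, dotProduct_add, dotProduct_smul, smul_eq_mul]
  nlinarith

lemma integrable_sigmoid_mul {x : Ω → ι → ℝ} (hx2 : ∀ j, MemLp (fun ω => x ω j) 2 P)
    (θ : ι → ℝ) (j k : ι) :
    Integrable (fun ω => Real.sigmoid (x ω ⬝ᵥ θ) * (1 - Real.sigmoid (x ω ⬝ᵥ θ)) *
      (x ω j * x ω k)) P := by
  have hσ : AEStronglyMeasurable (fun ω => Real.sigmoid (x ω ⬝ᵥ θ)) P :=
    continuous_sigmoid.comp_aestronglyMeasurable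
      (Finset.aestronglyMeasurable_fun_sum _ fun j _ => (hx2 j).aestronglyMeasurable.mul_const _)
  refine ((hx2 j).integrable_mul (hx2 k)).bdd_mul (c := 1)
    (hσ.mul (aestronglyMeasurable_const.sub hσ)) (Eventually.of_forall fun ω => ?_)
  have h0 := Real.sigmoid_nonneg (x ω ⬝ᵥ θ)
  have h1 := Real.sigmoid_le_one (x ω ⬝ᵥ θ)
  rw [Real.norm_eq_abs, abs_le]
  constructor <;> nlinarith

variable [IsProbabilityMeasure P]

/-- The third order remainder of the normalised expansion vanishes under second moments. -/
lemma IsIID.remainder_le (hW : IsIID P W) {S : 𝒲 → ℝ} (hS : Measurable S)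
    (hS0 : ∀ w, 0 ≤ S w) (hS2 : MemLp (fun ω => S (W 0 ω)) 2 P) {η : ℝ} (hη : 0 < η) :
    WithHighProb P fun n ω => ∑ i ∈ Finset.range n,
      min 1 ((Real.sqrt n)⁻¹ * S (W i ω)) * ((Real.sqrt n)⁻¹ * S (W i ω)) ^ 2 ≤ η := by
  have hmeas : ∀ r : ℝ, Measurable fun w => min 1 (r * S w) * (r * S w) ^ 2 := fun r => by
    fun_prop
  have hr : ∀ n : ℕ, 0 ≤ (Real.sqrt n)⁻¹ := fun n => by positivity
  have hle : ∀ (n : ℕ) w, |min 1 ((Real.sqrt n)⁻¹ * S w)| ≤ 1 := fun n w => by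
    rw [abs_of_nonneg (le_min zero_le_one (mul_nonneg (hr n) (hS0 w)))]
    exact min_le_left _ _
  have hsq := hS2.integrable_sq
  have hint : ∀ n : ℕ, Integrable (fun ω => min 1 ((Real.sqrt n)⁻¹ * S (W 0 ω)) *
      ((Real.sqrt n)⁻¹ * S (W 0 ω)) ^ 2) P := fun n => by
    simp only [mul_pow]
    refine (hsq.const_mul _).bdd_mul (c := 1) ?_ (Eventually.of_forall fun ω => hle n _)
    exact ((measurable_const.min (hS.const_mul _)).comp_aemeasurable
      (hW.ident 0).aemeasurable_fst).aestronglyMeasurable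
  refine WithHighProb.le_of_integral_tendsto_zero
    (fun n ω => Finset.sum_nonneg fun i _ =>
      mul_nonneg (le_min zero_le_one (mul_nonneg (hr n) (hS0 _))) (sq_nonneg _))
    (fun n => integrable_finsetSum _ fun i _ => (hW.integrable_iff (hmeas _) i).2 (hint n)) ?_ hη
  -- The expected sum equals E[min(1, S/√n) S²] for n > 0: the n terms cancel the factor 1/n from
  -- the square. It tends to 0 by dominated convergence with bound S².
  have hlim : Tendsto (fun n : ℕ => ∫ ω, min 1 ((Real.sqrt n)⁻¹ * S (W 0 ω)) * S (W 0 ω) ^ 2 ∂P)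
      atTop (𝓝 (∫ _ω, (0 : ℝ) ∂P)) := by
    refine tendsto_integral_of_dominated_convergence (fun ω => S (W 0 ω) ^ 2) (fun n => ?_) hsq
      (fun n => Eventually.of_forall fun ω => ?_) (Eventually.of_forall fun ω => ?_)
    · exact (((measurable_const.min (hS.const_mul _)).mul (hS.pow_const 2)).comp_aemeasurable
        (hW.ident 0).aemeasurable_fst).aestronglyMeasurable
    · rw [Real.norm_eq_abs, abs_mul, abs_of_nonneg (sq_nonneg (S (W 0 ω)))]
      exact mul_le_of_le_one_left (sq_nonneg _) (hle n _)
    · have h1 : Tendsto (fun n : ℕ => (Real.sqrt n)⁻¹) atTop (𝓝 0) :=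
        tendsto_inv_atTop_zero.comp (Real.tendsto_sqrt_atTop.comp tendsto_natCast_atTop_atTop)
      have h2 := ((tendsto_const_nhds (x := (1 : ℝ))).min (h1.mul_const (S (W 0 ω)))).mul_const
        (S (W 0 ω) ^ 2)
      simpa using h2
  rw [integral_zero] at hlim
  refine hlim.congr' ?_
  filter_upwards [eventually_gt_atTop 0] with n hn
  have hn' : (0 : ℝ) < n := Nat.cast_pos.2 hn
  rw [hW.integral_sum (hmeas _) (hint n), ← integral_const_mul]
  refine integral_congr_ae (Eventually.of_forall fun ω => ?_)
  have h3 : ((Real.sqrt n)⁻¹) ^ 2 = (n : ℝ)⁻¹ := by rw [inv_pow, Real.sq_sqrt hn'.le]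
  simp only [mul_pow, h3]
  field_simp

/-- Uniform local asymptotic quadraticity of the logistic log-likelihood. -/
lemma IsIID.logistic_expansion (hW : IsIID P W) {x : 𝒲 → ι → ℝ} (hx : Measurable x)
    (a : 𝒲 → ℝ) (hx2 : ∀ j, MemLp (fun ω => x (W 0 ω) j) 2 P) (θ : ι → ℝ)
    {R η : ℝ} (hR : 0 ≤ R) (hη : 0 < η) :
    WithHighProb P fun n ω => ∀ u : ι → ℝ, ‖u‖ ≤ R →
      |∑ i ∈ Finset.range n, logisticLoss (a (W i ω)) (x (W i ω) ⬝ᵥ (θ + (Real.sqrt n)⁻¹ • u)) -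
        ∑ i ∈ Finset.range n, logisticLoss (a (W i ω)) (x (W i ω) ⬝ᵥ θ) -
        (u ⬝ᵥ logisticInfo P (fun ω => x (W 0 ω)) θ *ᵥ u / 2 -
          normalizedScore W x a θ n ω ⬝ᵥ u)| ≤ η := by
  -- An envelope for |x ⬝ᵥ u| over ‖u‖ ≤ R, which makes the remainder bound uniform in u.
  set S : 𝒲 → ℝ := fun w => (∑ j, |x w j|) * R with hSdef
  have hS : Measurable S := by fun_prop
  have hS0 : ∀ w, 0 ≤ S w := fun w => mul_nonneg (Finset.sum_nonneg fun _ _ => abs_nonneg _) hR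
  have hS2 : MemLp (fun ω => S (W 0 ω)) 2 P :=
    (memLp_finsetSum _ fun j _ => (hx2 j).abs).mul_const R
  set w : 𝒲 → ℝ := fun v => Real.sigmoid (x v ⬝ᵥ θ) * (1 - Real.sigmoid (x v ⬝ᵥ θ)) with hw_def
  have hσ : Measurable fun v => Real.sigmoid (x v ⬝ᵥ θ) :=
    continuous_sigmoid.measurable.comp (measurable_dotProduct_const hx θ)
  have hw : Measurable w := hσ.mul (hσ.const_sub 1)
  have hint : ∀ j k, Integrable (fun ω => w (W 0 ω) * (x (W 0 ω) j * x (W 0 ω) k)) P :=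
    integrable_sigmoid_mul hx2 θ
  have hη' : 0 < η / (R ^ 2 + 1) := by positivity
  have hA := hW.quadratic_form_weak_law hw hx hint hη'
  have hB := hW.remainder_le hS hS0 hS2 (half_pos hη)
  refine (hA.and hB).mono ?_
  filter_upwards [eventually_gt_atTop 0] with n hn ω ⟨h1, h2⟩ u hu
  have hn' : (0 : ℝ) < n := Nat.cast_pos.2 hn
  set r := (Real.sqrt n)⁻¹ with hr_def
  have hr : 0 ≤ r := by positivity
  have hr2 : r ^ 2 = (n : ℝ)⁻¹ := by rw [hr_def, inv_pow, Real.sq_sqrt hn'.le]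
  have hscore : normalizedScore W x a θ n ω ⬝ᵥ u = ∑ i ∈ Finset.range n,
      (a (W i ω) - Real.sigmoid (x (W i ω) ⬝ᵥ θ)) * (r * (x (W i ω) ⬝ᵥ u)) := by
    simp only [normalizedScore, dotProduct, Finset.mul_sum, Finset.sum_mul]
    rw [Finset.sum_comm]
    refine Finset.sum_congr rfl fun i _ => Finset.sum_congr rfl fun j _ => ?_
    ring
  have hinfo : u ⬝ᵥ logisticInfo P (fun ω => x (W 0 ω)) θ *ᵥ u
      = ∫ ω, w (W 0 ω) * (x (W 0 ω) ⬝ᵥ u) ^ 2 ∂P := (integral_mul_dotProduct_sq hint u).symm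
  rw [hscore, hinfo]
  set Q := ∫ ω, w (W 0 ω) * (x (W 0 ω) ⬝ᵥ u) ^ 2 ∂P
  have hquad : (n : ℝ)⁻¹ * ∑ i ∈ Finset.range n, w (W i ω) * (x (W i ω) ⬝ᵥ u) ^ 2 =
      ∑ i ∈ Finset.range n, w (W i ω) * (r * (x (W i ω) ⬝ᵥ u)) ^ 2 := by
    rw [← hr2, Finset.mul_sum]
    exact Finset.sum_congr rfl fun i _ => by ring
  have h1' := h1 u
  rw [hquad] at h1'
  have h1'' : η / (R ^ 2 + 1) * ‖u‖ ^ 2 ≤ η := by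
    rw [div_mul_eq_mul_div, div_le_iff₀ (by positivity)]
    have : ‖u‖ ^ 2 ≤ R ^ 2 := by gcongr
    nlinarith
  have hrem : |∑ i ∈ Finset.range n, (phi (x (W i ω) ⬝ᵥ θ + r * (x (W i ω) ⬝ᵥ u)) -
      phi (x (W i ω) ⬝ᵥ θ) - Real.sigmoid (x (W i ω) ⬝ᵥ θ) * (r * (x (W i ω) ⬝ᵥ u)) -
      w (W i ω) * (r * (x (W i ω) ⬝ᵥ u)) ^ 2 / 2)| ≤ η / 2 := by
    refine (Finset.abs_sum_le_sum_abs _ _).trans (le_trans ?_ h2)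
    refine Finset.sum_le_sum fun i _ => (abs_phi_sub_quadratic_le _ _).trans ?_
    have hs : |r * (x (W i ω) ⬝ᵥ u)| ≤ r * S (W i ω) := by
      rw [abs_mul, abs_of_nonneg hr]
      refine mul_le_mul_of_nonneg_left ((abs_dotProduct_le _ _).trans ?_) hr
      exact mul_le_mul_of_nonneg_left hu (Finset.sum_nonneg fun _ _ => abs_nonneg _)
    rw [← sq_abs (r * (x (W i ω) ⬝ᵥ u))]
    gcongr
  -- The response enters the loss linearly and cancels against the score, so no condition on `a` is
  -- needed. What remains is the Taylor remainder and half the error in the law of large numbers,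
  -- each at most η/2.
  have hdecomp : ∑ i ∈ Finset.range n, logisticLoss (a (W i ω)) (x (W i ω) ⬝ᵥ (θ + r • u)) -
        ∑ i ∈ Finset.range n, logisticLoss (a (W i ω)) (x (W i ω) ⬝ᵥ θ) -
        (Q / 2 - ∑ i ∈ Finset.range n,
          (a (W i ω) - Real.sigmoid (x (W i ω) ⬝ᵥ θ)) * (r * (x (W i ω) ⬝ᵥ u))) =
      ∑ i ∈ Finset.range n, (phi (x (W i ω) ⬝ᵥ θ + r * (x (W i ω) ⬝ᵥ u)) -
        phi (x (W i ω) ⬝ᵥ θ) - Real.sigmoid (x (W i ω) ⬝ᵥ θ) * (r * (x (W i ω) ⬝ᵥ u)) -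
        w (W i ω) * (r * (x (W i ω) ⬝ᵥ u)) ^ 2 / 2) +
      (∑ i ∈ Finset.range n, w (W i ω) * (r * (x (W i ω) ⬝ᵥ u)) ^ 2 - Q) / 2 := by
    simp only [logisticLoss, dotProduct_add, dotProduct_smul, smul_eq_mul]
    rw [sub_div _ Q, Finset.sum_div]
    have : ∀ A B C D E : ℝ, A - B + C = D + E → A - B - (Q / 2 - C) = D + (E - Q / 2) := by
      intros; linarith
    apply this
    rw [← Finset.sum_sub_distrib, ← Finset.sum_add_distrib, ← Finset.sum_add_distrib]
    exact Finset.sum_congr rfl fun i _ => by ring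
  rw [hdecomp]
  rw [abs_le] at h1' hrem ⊢
  constructor <;> linarith

/-- Asymptotic linearity of penalised logistic regression when the penalty is convex and locally
negligible. -/
lemma IsIID.penalized_logistic_asymptotically_linear [DecidableEq ι] (hW : IsIID P W)
    {x : 𝒲 → ι → ℝ}
    (hx : Measurable x) {a : 𝒲 → ℝ} (ha : Measurable a)
    (hx2 : ∀ j, MemLp (fun ω => x (W 0 ω) j) 2 P) (θ : ι → ℝ)
    (hscore2 : ∀ j, MemLp (fun ω =>
      (a (W 0 ω) - Real.sigmoid (x (W 0 ω) ⬝ᵥ θ)) * x (W 0 ω) j) 2 P)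
    (hscore : ∀ j, ∫ ω, (a (W 0 ω) - Real.sigmoid (x (W 0 ω) ⬝ᵥ θ)) * x (W 0 ω) j ∂P = 0)
    (hinfo : (logisticInfo P (fun ω => x (W 0 ω)) θ).PosDef)
    {pen : ℕ → Ω → (ι → ℝ) → ℝ} {est : ℕ → Ω → ι → ℝ}
    (hmin : WithHighProb P fun n ω => ConvexOn ℝ Set.univ (pen n ω) ∧ ∀ θ',
      ∑ i ∈ Finset.range n, logisticLoss (a (W i ω)) (x (W i ω) ⬝ᵥ est n ω) +
        pen n ω (est n ω) ≤
      ∑ i ∈ Finset.range n, logisticLoss (a (W i ω)) (x (W i ω) ⬝ᵥ θ') + pen n ω θ')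
    (hpen : ∀ R η : ℝ, 0 ≤ R → 0 < η → WithHighProb P fun n ω => ∀ u : ι → ℝ, ‖u‖ ≤ R →
      |pen n ω (θ + (Real.sqrt n)⁻¹ • u) - pen n ω θ| ≤ η)
    {δ : ℝ} (hδ : 0 < δ) :
    WithHighProb P fun n ω => ‖Real.sqrt n • (est n ω - θ) -
      (logisticInfo P (fun ω => x (W 0 ω)) θ)⁻¹ *ᵥ normalizedScore W x a θ n ω‖ < δ := by
  set M := logisticInfo P (fun ω => x (W 0 ω)) θ with hM
  have hσ : Measurable fun v => Real.sigmoid (x v ⬝ᵥ θ) :=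
    continuous_sigmoid.measurable.comp (measurable_dotProduct_const hx θ)
  obtain ⟨c, hc, hle⟩ := exists_le_quadratic_form fun u hu => by
    simpa using hinfo.dotProduct_mulVec_pos hu
  have hdet : IsUnit M.det := (Matrix.isUnit_iff_isUnit_det _).1 hinfo.isUnit
  have hsymm : Mᵀ = M := by simpa [Matrix.IsHermitian] using hinfo.isHermitian
  have hB : BoundedInProb P fun n ω => ∑ j, |normalizedScore W x a θ n ω j| :=
    BoundedInProb.sum_abs _ fun j => hW.boundedInProb_normalized_sum
      (f := fun v => (a v - Real.sigmoid (x v ⬝ᵥ θ)) * x v j) (by fun_prop) (hscore2 j) (hscore j)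
  set L := ∑ j, ∑ k, |M⁻¹ j k| with hL
  have hL0 : 0 ≤ L := Finset.sum_nonneg fun _ _ => Finset.sum_nonneg fun _ _ => abs_nonneg _
  have hbound : ∀ v : ι → ℝ, ‖M⁻¹ *ᵥ v‖ ≤ L * ∑ j, |v j| := fun v => by
    have hv : ‖v‖ ≤ ∑ j, |v j| := (pi_norm_le_iff_of_nonneg
      (Finset.sum_nonneg fun _ _ => abs_nonneg _)).2 fun j =>
        Finset.single_le_sum (f := fun j => |v j|) (fun _ _ => abs_nonneg _) (Finset.mem_univ j)
    refine (pi_norm_le_iff_of_nonneg (mul_nonneg hL0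
      (Finset.sum_nonneg fun _ _ => abs_nonneg _))).2 fun j => ?_
    refine (abs_dotProduct_le _ _).trans (mul_le_mul ?_ hv (norm_nonneg _) hL0)
    exact Finset.single_le_sum (f := fun j => ∑ k, |M⁻¹ j k|)
      (fun _ _ => Finset.sum_nonneg fun _ _ => abs_nonneg _) (Finset.mem_univ j)
  refine hB.withHighProb fun K => ?_
  -- The ball of radius R contains the minimiser M⁻¹V of the quadratic together with the δ-sphere
  -- around it.
  set R := L * |K| + δ with hR
  have hR0 : 0 ≤ R := by positivity
  -- On the sphere the quadratic exceeds its minimum by at least cδ²/2. The approximation error is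
  -- at most 2η at each of the two points compared, hence cδ²/4 in total.
  set η := c * δ ^ 2 / 16 with hη_def
  have hη : 0 < η := by positivity
  refine ((hmin.and (hW.logistic_expansion hx a hx2 θ hR0 hη)).and (hpen R η hR0 hη)).mono ?_
  filter_upwards [eventually_gt_atTop 0] with n hn ω ⟨⟨⟨hconv, hopt⟩, hexp⟩, hpn⟩ hK
  have hs : 0 < Real.sqrt n := Real.sqrt_pos.2 (Nat.cast_pos.2 hn)
  set r := (Real.sqrt n)⁻¹ with hr_def
  set V := normalizedScore W x a θ n ω with hV
  set u₀ := M⁻¹ *ᵥ V with hu₀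
  have hu₀R : ‖u₀‖ ≤ L * |K| := by
    refine (hbound V).trans (mul_le_mul_of_nonneg_left ?_ hL0)
    exact (le_abs_self _).trans (hK.trans (le_abs_self K))
  set F : (ι → ℝ) → ℝ := fun θ' =>
    ∑ i ∈ Finset.range n, logisticLoss (a (W i ω)) (x (W i ω) ⬝ᵥ θ') + pen n ω θ' with hF
  have hFconv : ConvexOn ℝ Set.univ F :=
    (convexOn_sum_logisticLoss _ (fun i => x (W i ω)) fun i => a (W i ω)).add hconv
  have hgconv : ConvexOn ℝ Set.univ fun u => F (θ + r • u) := by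
    refine ⟨convex_univ, fun u _ v _ s t hs ht hst => ?_⟩
    have h := hFconv.2 (Set.mem_univ (θ + r • u)) (Set.mem_univ (θ + r • v)) hs ht hst
    have h2 : θ + r • (s • u + t • v) = s • (θ + r • u) + t • (θ + r • v) := by
      have : θ = (s + t) • θ := by rw [hst, one_smul]
      conv_lhs => rw [this]
      module
    rw [← h2] at h
    exact h
  have hMu₀ : M *ᵥ u₀ = V := by
    rw [hu₀, mulVec_mulVec, mul_nonsing_inv _ hdet, one_mulVec]
  have happrox : ∀ u, ‖u‖ ≤ R →
      |F (θ + r • u) - F θ - (u ⬝ᵥ M *ᵥ u / 2 - V ⬝ᵥ u)| ≤ 2 * η := fun u hu => by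
    have h1 := abs_le.1 (hexp u hu)
    have h2 := abs_le.1 (hpn u hu)
    simp only [hF]
    rw [abs_le]
    constructor <;> linarith [h1.1, h1.2, h2.1, h2.2]
  refine norm_sub_lt_of_convexOn_of_sphere_lt hgconv hδ (fun v hv => ?_) ?_
  · have hvR : ‖v‖ ≤ R := by
      have := norm_le_norm_add_norm_sub' v u₀
      linarith
    have h1 := abs_le.1 (happrox v hvR)
    have h2 := abs_le.1 (happrox u₀ (hu₀R.trans (by linarith)))
    have h3 := hle (v - u₀)
    rw [hv] at h3
    -- Completing the square, using symmetry of M and M u₀ = V.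
    have h4 : (v - u₀) ⬝ᵥ M *ᵥ (v - u₀) =
        v ⬝ᵥ M *ᵥ v - 2 * (V ⬝ᵥ v) + u₀ ⬝ᵥ M *ᵥ u₀ := by
      have h5 : u₀ ⬝ᵥ M *ᵥ v = V ⬝ᵥ v := by
        rw [dotProduct_mulVec, ← mulVec_transpose, hsymm, hMu₀]
      rw [mulVec_sub, dotProduct_sub, sub_dotProduct, sub_dotProduct, h5, hMu₀,
        dotProduct_comm v V]
      ring
    have h6 : u₀ ⬝ᵥ M *ᵥ u₀ = V ⬝ᵥ u₀ := by rw [hMu₀, dotProduct_comm]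
    linarith [h1.1, h2.2, mul_pos hc (pow_pos hδ 2)]
  · have h := hopt (θ + r • u₀)
    have h2 : θ + r • Real.sqrt n • (est n ω - θ) = est n ω := by
      rw [smul_smul, hr_def, inv_mul_cancel₀ hs.ne', one_smul, add_sub_cancel]
    simp only [h2]
    exact h

end GOAL

/-! ### The penalised criterion for fixed data. -/

namespace GOAL

variable {p : ℕ} {n : ℕ} {x : ℕ → Fin p → ℝ} {a : ℕ → ℝ} {lam1 lam2 γ : ℝ} {b α : Fin p → ℝ}

lemma negLogLik_eq_sum_logisticLoss (α : Fin p → ℝ) :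
    negLogLik n x a α = ∑ i ∈ Finset.range n, logisticLoss (a i) (x i ⬝ᵥ α) := rfl

lemma objective_zero_ne_top : objective n x a lam1 lam2 γ b 0 ≠ ⊤ := by
  simp [objective]

lemma objective_eq_coe {q : ℝ≥0∞}
    (hq : ENNReal.ofReal lam1 * ∑ j, weight γ (b j) * ENNReal.ofReal |α j| = q) (hq' : q ≠ ⊤) :
    objective n x a lam1 lam2 γ b α =
      ((negLogLik n x a α + lam2 * ∑ j, α j ^ 2 + q.toReal : ℝ) : EReal) := by
  rw [objective, hq, EReal.coe_add _ q.toReal, EReal.coe_ennreal_toReal hq']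

/-- Comparison with α = 0, where the criterion is finite even if some weights are infinite. This is
what allows extended-real inequalities to be read in ℝ. -/
lemma IsGOAL.penalty_ne_top (h : IsGOAL n x a lam1 lam2 γ b α) :
    ENNReal.ofReal lam1 * ∑ j, weight γ (b j) * ENNReal.ofReal |α j| ≠ ⊤ := by
  intro htop
  have h1 := h 0
  rw [objective, htop, EReal.coe_ennreal_top, EReal.coe_add_top, top_le_iff] at h1
  exact objective_zero_ne_top h1

/-- A coefficient whose adaptive weight dominates the slope of the likelihood is set to zero. -/
lemma IsGOAL.eq_zero_of_sum_lt_weight (ha : ∀ i, a i = 0 ∨ a i = 1) (hlam2 : 0 ≤ lam2)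
    (h : IsGOAL n x a lam1 lam2 γ b α) {j : Fin p}
    (hj : ENNReal.ofReal (∑ i ∈ Finset.range n, |x i j|) < ENNReal.ofReal lam1 * weight γ (b j)) :
    α j = 0 := by
  by_contra hne
  have hpos : 0 < |α j| := abs_pos.2 hne
  -- The competitor drops coordinate j alone: it saves `q`, keeps the rest `r` of the penalty, and
  -- does not increase the ridge term.
  set α' := Function.update α j 0 with hα'
  set q := ENNReal.ofReal lam1 * (weight γ (b j) * ENNReal.ofReal |α j|) with hq
  set r := ENNReal.ofReal lam1 *
    ∑ k ∈ Finset.univ.erase j, weight γ (b k) * ENNReal.ofReal |α k| with hr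
  have hsplit : ENNReal.ofReal lam1 * ∑ k, weight γ (b k) * ENNReal.ofReal |α k| = q + r := by
    rw [← Finset.add_sum_erase _ _ (Finset.mem_univ j), mul_add]
  have hsplit' : ENNReal.ofReal lam1 * ∑ k, weight γ (b k) * ENNReal.ofReal |α' k| = r := by
    rw [← Finset.add_sum_erase _ _ (Finset.mem_univ j), hr]
    simp only [hα', Function.update_self, abs_zero, ENNReal.ofReal_zero, mul_zero, zero_add]
    congr 1
    refine Finset.sum_congr rfl fun k hk => ?_
    rw [Function.update_of_ne (Finset.ne_of_mem_erase hk)]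
  have hfin := h.penalty_ne_top
  rw [hsplit] at hfin
  have hqf : q ≠ ⊤ := fun hc => hfin (by rw [hc, top_add])
  have hrf : r ≠ ⊤ := fun hc => hfin (by rw [hc, add_top])
  have h1 := h α'
  rw [objective_eq_coe hsplit hfin, objective_eq_coe hsplit' hrf, EReal.coe_le_coe_iff,
    ENNReal.toReal_add hqf hrf] at h1
  have h2 : ∑ k, α' k ^ 2 ≤ ∑ k, α k ^ 2 := Finset.sum_le_sum fun k _ => by
    by_cases hk : k = j
    · subst hk
      simp [hα', sq_nonneg]
    · rw [hα', Function.update_of_ne hk]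
  have h3 : negLogLik n x a α' - negLogLik n x a α ≤
      (∑ i ∈ Finset.range n, |x i j|) * |α j| := by
    rw [negLogLik_eq_sum_logisticLoss, negLogLik_eq_sum_logisticLoss, ← Finset.sum_sub_distrib,
      Finset.sum_mul]
    refine Finset.sum_le_sum fun i _ =>
      (le_abs_self _).trans ((abs_logistic_loss_sub_le (ha i) _ _).trans (le_of_eq ?_))
    have h4 : α' - α = -Pi.single j (α j) := by
      ext k
      by_cases hk : k = j
      · subst hk
        simp [hα']
      · simp [hα', hk]
    rw [← dotProduct_sub, h4, dotProduct_neg, dotProduct_single, abs_neg, abs_mul]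
  -- `hj` multiplied by |α j| > 0: the saving exceeds the largest possible loss in likelihood,
  -- contradicting minimality.
  have h5 : (∑ i ∈ Finset.range n, |x i j|) * |α j| < q.toReal := by
    rw [← ENNReal.ofReal_lt_iff_lt_toReal (by positivity) hqf,
      ENNReal.ofReal_mul (Finset.sum_nonneg fun _ _ => abs_nonneg _), hq, ← mul_assoc]
    exact ENNReal.mul_lt_mul_left (ENNReal.ofReal_pos.2 hpos).ne' ENNReal.ofReal_ne_top hj
  have h6 := mul_le_mul_of_nonneg_left h2 hlam2
  linarith

lemma weight_eq_ofReal {β : ℝ} (hβ : β ≠ 0) : weight γ β = ENNReal.ofReal (|β| ^ (-γ)) :=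
  ENNReal.ofReal_rpow_of_pos (abs_pos.2 hβ)

/-- Extension by zero of a coefficient vector supported on `s`. -/
def extend (s : Finset (Fin p)) (θ : s → ℝ) (j : Fin p) : ℝ :=
  if h : j ∈ s then θ ⟨j, h⟩ else 0

variable {s : Finset (Fin p)}

lemma extend_coe (θ : s → ℝ) (j : s) : extend s θ j = θ j := by
  simp [extend]

lemma extend_of_notMem (θ : s → ℝ) {j : Fin p} (hj : j ∉ s) : extend s θ j = 0 := by
  simp [extend, hj]

lemma extend_restrict (hα : ∀ j, j ∉ s → α j = 0) : extend s (fun j => α j) = α := by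
  ext j
  by_cases hj : j ∈ s
  · simp [extend, hj]
  · rw [extend_of_notMem _ hj, hα j hj]

lemma sum_eq_sum_subtype {M : Type*} [AddCommMonoid M] {f : Fin p → M}
    (hf : ∀ j, j ∉ s → f j = 0) : ∑ j, f j = ∑ j : s, f j := by
  rw [Finset.sum_coe_sort s f]
  exact (Finset.sum_subset (Finset.subset_univ s) fun j _ hj => hf j hj).symm

lemma dotProduct_extend (v : Fin p → ℝ) (θ : s → ℝ) :
    v ⬝ᵥ extend s θ = (fun j : s => v j) ⬝ᵥ θ := by
  rw [dotProduct, sum_eq_sum_subtype (s := s) fun j hj => by rw [extend_of_notMem θ hj, mul_zero]]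
  simp only [extend_coe, dotProduct]

/-- The criterion at coefficient vectors supported on covariates with finite weights. -/
lemma objective_extend (hlam1 : 0 ≤ lam1) (hb : ∀ j ∈ s, b j ≠ 0) (θ : s → ℝ) :
    objective n x a lam1 lam2 γ b (extend s θ) =
      ((∑ i ∈ Finset.range n, logisticLoss (a i) ((fun j : s => x i j) ⬝ᵥ θ) +
        ∑ j : s, (lam1 * |b j| ^ (-γ) * |θ j| + lam2 * θ j ^ 2) : ℝ) : EReal) := by
  have hnn : ∀ j : s, 0 ≤ |b j| ^ (-γ) * |θ j| := fun j => by positivity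
  have hq : ENNReal.ofReal lam1 * ∑ j, weight γ (b j) * ENNReal.ofReal |extend s θ j| =
      ENNReal.ofReal (lam1 * ∑ j : s, |b j| ^ (-γ) * |θ j|) := by
    rw [sum_eq_sum_subtype (s := s) fun j hj => by simp [extend_of_notMem θ hj],
      ENNReal.ofReal_mul hlam1, ENNReal.ofReal_sum_of_nonneg fun j _ => hnn j]
    congr 1
    refine Finset.sum_congr rfl fun j _ => ?_
    rw [extend_coe, weight_eq_ofReal (hb j j.2), ENNReal.ofReal_mul (by positivity)]
  rw [objective_eq_coe hq ENNReal.ofReal_ne_top, ENNReal.toReal_ofReal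
    (mul_nonneg hlam1 (Finset.sum_nonneg fun j _ => hnn j)),
    sum_eq_sum_subtype (s := s) (f := fun j => extend s θ j ^ 2)
      fun j hj => by simp [extend_of_notMem θ hj], negLogLik_eq_sum_logisticLoss]
  simp only [dotProduct_extend, extend_coe, Finset.sum_add_distrib, ← Finset.mul_sum, mul_assoc]
  congr 1
  ring

/-- Vectors on `s`, extended by zero, are admissible competitors, and their penalty is finite
because the weights on `s` are. A minimiser vanishing off `s` thus solves the smaller real-valued
problem. -/
lemma IsGOAL.isMin_restrict (h : IsGOAL n x a lam1 lam2 γ b α) (hlam1 : 0 ≤ lam1)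
    (hb : ∀ j ∈ s, b j ≠ 0) (hα : ∀ j, j ∉ s → α j = 0) (θ : s → ℝ) :
    ∑ i ∈ Finset.range n, logisticLoss (a i) ((fun j : s => x i j) ⬝ᵥ fun j : s => α j) +
        ∑ j : s, (lam1 * |b j| ^ (-γ) * |α j| + lam2 * α j ^ 2) ≤
      ∑ i ∈ Finset.range n, logisticLoss (a i) ((fun j : s => x i j) ⬝ᵥ θ) +
        ∑ j : s, (lam1 * |b j| ^ (-γ) * |θ j| + lam2 * θ j ^ 2) := by
  have h1 := h (extend s θ)
  rw [← extend_restrict hα, objective_extend hlam1 hb, objective_extend hlam1 hb,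
    EReal.coe_le_coe_iff] at h1
  exact h1

lemma convexOn_elasticNet {ι : Type*} [Fintype ι] {κ : ι → ℝ} (hκ : ∀ j, 0 ≤ κ j)
    (hlam2 : 0 ≤ lam2) :
    ConvexOn ℝ Set.univ fun θ : ι → ℝ => ∑ j, (κ j * |θ j| + lam2 * θ j ^ 2) := by
  refine ⟨convex_univ, fun u _ v _ r t hr ht hrt => ?_⟩
  simp only [smul_eq_mul, Finset.mul_sum, ← Finset.sum_add_distrib]
  refine Finset.sum_le_sum fun j _ => ?_
  have h1 : |r * u j + t * v j| ≤ r * |u j| + t * |v j| := by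
    refine (abs_add_le _ _).trans ?_
    rw [abs_mul, abs_mul, abs_of_nonneg hr, abs_of_nonneg ht]
  have h2 : (r * u j + t * v j) ^ 2 ≤ r * u j ^ 2 + t * v j ^ 2 := by
    obtain rfl : t = 1 - r := by linarith
    -- The convexity gap of the square is r t (u j - v j)².
    nlinarith [mul_nonneg (mul_nonneg hr ht) (sq_nonneg (u j - v j))]
  simp only [Pi.add_apply, Pi.smul_apply, smul_eq_mul]
  nlinarith [mul_le_mul_of_nonneg_left h1 (hκ j), mul_le_mul_of_nonneg_left h2 hlam2]

/-- Local variation of the elastic net penalty. -/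
lemma abs_elasticNet_sub_le {ι : Type*} [Fintype ι] {κ C : ι → ℝ} (hκ : ∀ j, 0 ≤ κ j)
    (hκC : ∀ j, κ j ≤ lam1 * C j) (hlam2 : 0 ≤ lam2) {r : ℝ} (hr0 : 0 ≤ r)
    (hr1 : r ≤ 1) {R : ℝ} (θ u : ι → ℝ) (hu : ‖u‖ ≤ R) :
    |∑ j, (κ j * |(θ + r • u) j| + lam2 * (θ + r • u) j ^ 2) -
      ∑ j, (κ j * |θ j| + lam2 * θ j ^ 2)| ≤
      ∑ j, (lam1 * r * (C j * R) + lam2 * r * (2 * |θ j| * R + R ^ 2)) := by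
  rw [← Finset.sum_sub_distrib]
  refine (Finset.abs_sum_le_sum_abs _ _).trans (Finset.sum_le_sum fun j _ => ?_)
  have huj : |u j| ≤ R := (norm_le_pi_norm u j).trans hu
  have hR : 0 ≤ R := (abs_nonneg _).trans huj
  simp only [Pi.add_apply, Pi.smul_apply, smul_eq_mul]
  have h1 : |(|θ j + r * u j| - |θ j|)| ≤ r * R := by
    refine (abs_abs_sub_abs_le_abs_sub _ _).trans ?_
    rw [add_sub_cancel_left, abs_mul, abs_of_nonneg hr0]
    gcongr
  have h2 : |(θ j + r * u j) ^ 2 - θ j ^ 2| ≤ r * (2 * |θ j| * R + R ^ 2) := by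
    have h3 : (θ j + r * u j) ^ 2 - θ j ^ 2 = r * (2 * θ j * u j + r * u j ^ 2) := by ring
    rw [h3, abs_mul, abs_of_nonneg hr0]
    refine mul_le_mul_of_nonneg_left ((abs_add_le _ _).trans (add_le_add ?_ ?_)) hr0
    · rw [abs_mul, abs_mul, abs_two]
      gcongr
    · rw [abs_of_nonneg (by positivity), ← sq_abs (u j)]
      refine (mul_le_of_le_one_left (by positivity) hr1).trans ?_
      gcongr
  have h4 : κ j * |θ j + r * u j| + lam2 * (θ j + r * u j) ^ 2 - (κ j * |θ j| + lam2 * θ j ^ 2) =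
      κ j * (|θ j + r * u j| - |θ j|) + lam2 * ((θ j + r * u j) ^ 2 - θ j ^ 2) := by ring
  rw [h4]
  refine (abs_add_le _ _).trans (add_le_add ?_ ?_)
  · rw [abs_mul, abs_of_nonneg (hκ j)]
    calc κ j * |(|θ j + r * u j| - |θ j|)| ≤ lam1 * C j * (r * R) :=
          mul_le_mul (hκC j) h1 (abs_nonneg _) ((hκ j).trans (hκC j))
      _ = _ := by ring
  · rw [abs_mul, abs_of_nonneg hlam2, mul_assoc]
    gcongr

end GOAL

/-! ### Multivariate central limit theorem by the Cramér–Wold device. -/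

namespace GOAL

variable {Ω : Type*} [MeasurableSpace Ω] {P : Measure Ω} [IsProbabilityMeasure P]
  {𝒲 : Type*} [MeasurableSpace 𝒲] {W : ℕ → Ω → 𝒲} {ι : Type*} [Fintype ι]

/-- The one-dimensional central limit theorem in terms of characteristic functions. -/
lemma IsIID.tendsto_charFun_normalized_sum (hW : IsIID P W) {f : 𝒲 → ℝ} (hf : Measurable f)
    (hL2 : MemLp (fun ω => f (W 0 ω)) 2 P) (hmean : ∫ ω, f (W 0 ω) ∂P = 0) :
    Tendsto (fun n : ℕ => charFun (P.map fun ω =>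
        (Real.sqrt n)⁻¹ * ∑ i ∈ Finset.range n, f (W i ω)) 1) atTop
      (𝓝 (Complex.exp (-((∫ ω, f (W 0 ω) ^ 2 ∂P : ℝ) : ℂ) / 2))) := by
  have hiid := hW.comp hf
  have h := tendstoInDistribution_inv_sqrt_mul_sum_sub (P := P)
    (P' := gaussianReal 0 Var[fun ω => f (W 0 ω); P].toNNReal)
    (X := fun i ω => f (W i ω)) (Y := id) ⟨by fun_prop, by simp⟩ hL2 hiid.indep hiid.ident
  -- Argument 1 is enough, since any other argument can be absorbed into `f`.
  have h2 := ProbabilityMeasure.tendsto_iff_tendsto_charFun.1 h.tendsto 1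
  simp only [hmean, mul_zero, sub_zero, ProbabilityMeasure.coe_mk, Measure.map_id,
    charFun_gaussianReal] at h2
  rw [variance_of_integral_eq_zero hL2.aestronglyMeasurable.aemeasurable hmean,
    Real.coe_toNNReal _ (integral_nonneg fun ω => sq_nonneg _)] at h2
  refine h2.congr_dist ?_ |>.trans (le_of_eq ?_)
  · simp
  · congr 2
    simp
    ring

/-- Central limit theorem for normalised sums, standardised by the covariance matrix. -/
theorem IsIID.tendstoInDistribution_inv_mulVec [DecidableEq ι] (hW : IsIID P W) {s : 𝒲 → ι → ℝ}
    (hs : Measurable s) (hs2 : ∀ j, MemLp (fun ω => s (W 0 ω) j) 2 P)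
    (hmean : ∀ j, ∫ ω, s (W 0 ω) j ∂P = 0) {M : Matrix ι ι ℝ} (hM : M.PosDef)
    (hcov : ∀ j k, ∫ ω, s (W 0 ω) j * s (W 0 ω) k ∂P = M j k) :
    TendstoInDistribution (fun (n : ℕ) ω => WithLp.toLp 2 (M⁻¹ *ᵥ fun j =>
        (Real.sqrt n)⁻¹ * ∑ i ∈ Finset.range n, s (W i ω) j))
      atTop id (fun _ => P) (multivariateGaussian (0 : EuclideanSpace ℝ ι) M⁻¹) := by
  have hWm : ∀ i, AEMeasurable (W i) P := fun i => (hW.ident i).aemeasurable_fst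
  have hm : ∀ n : ℕ, AEMeasurable (fun ω => WithLp.toLp 2 (M⁻¹ *ᵥ fun j =>
      (Real.sqrt n)⁻¹ * ∑ i ∈ Finset.range n, s (W i ω) j)) P := fun n => by
    have h1 : AEMeasurable (fun ω (j : ι) =>
        (Real.sqrt n)⁻¹ * ∑ i ∈ Finset.range n, s (W i ω) j) P := by
      refine aemeasurable_pi_lambda _ fun j => AEMeasurable.const_mul ?_ _
      exact Finset.aemeasurable_fun_sum _ fun i _ =>
        ((measurable_pi_apply j).comp hs).comp_aemeasurable (hWm i)
    have h2 : Measurable fun v : ι → ℝ => WithLp.toLp 2 (M⁻¹ *ᵥ v) := by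
      refine (WithLp.measurable_toLp 2 _).comp ?_
      unfold mulVec dotProduct
      fun_prop
    exact h2.comp_aemeasurable h1
  have hdet : IsUnit M.det := (Matrix.isUnit_iff_isUnit_det _).1 hM.isUnit
  have hinv := hM.inv
  have hsymm : (M⁻¹)ᵀ = M⁻¹ := by simpa [Matrix.IsHermitian] using hinv.isHermitian
  refine ⟨hm, by fun_prop, ProbabilityMeasure.tendsto_iff_tendsto_charFun.2 fun t => ?_⟩
  -- Testing M⁻¹S against t is testing S against v, by symmetry; the variance is vᵀMv = tᵀM⁻¹t.
  set v : ι → ℝ := M⁻¹ *ᵥ t.ofLp with hv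
  have hint : ∀ j k, Integrable (fun ω => (1 : ℝ) * (s (W 0 ω) j * s (W 0 ω) k)) P := fun j k => by
    simpa using! (hs2 j).integrable_mul (hs2 k)
  have hf : Measurable fun w => s w ⬝ᵥ v := measurable_dotProduct_const hs v
  have hL2 : MemLp (fun ω => s (W 0 ω) ⬝ᵥ v) 2 P :=
    memLp_finsetSum _ fun j _ => (hs2 j).mul_const (v j)
  have hf0 : ∫ ω, s (W 0 ω) ⬝ᵥ v ∂P = 0 := by
    simp only [dotProduct]
    rw [integral_finsetSum _ fun j _ => ((hs2 j).integrable one_le_two).mul_const _]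
    simp [integral_mul_const, hmean]
  have hvar : ∫ ω, (s (W 0 ω) ⬝ᵥ v) ^ 2 ∂P = t ⬝ᵥ M⁻¹ *ᵥ t := by
    have h := integral_mul_dotProduct_sq hint v
    simp only [one_mul, hcov] at h
    have hof : Matrix.of (fun j k => M j k) = M := rfl
    rw [h, hof, hv, mulVec_mulVec, mul_nonsing_inv _ hdet, one_mulVec, dotProduct_comm]
  have h := hW.tendsto_charFun_normalized_sum hf hL2 hf0
  rw [hvar] at h
  have hlim : charFun ((multivariateGaussian (0 : EuclideanSpace ℝ ι) M⁻¹).map id) t =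
      Complex.exp (-((t ⬝ᵥ M⁻¹ *ᵥ t : ℝ) : ℂ) / 2) := by
    rw [Measure.map_id, charFun_multivariateGaussian hinv.posSemidef]
    simp [neg_div]
  simp only [ProbabilityMeasure.coe_mk]
  rw [hlim]
  refine h.congr fun n => ?_
  rw [charFun_apply, charFun_apply, integral_map (hm n) (by fun_prop), integral_map _ (by fun_prop)]
  · refine integral_congr_ae (Eventually.of_forall fun ω => ?_)
    simp only
    congr 3
    rw [EuclideanSpace.inner_eq_star_dotProduct]
    simp only [star_trivial, RCLike.inner_apply, conj_trivial, one_mul]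
    have h1 : t.ofLp ⬝ᵥ M⁻¹ *ᵥ (fun j => (Real.sqrt n)⁻¹ * ∑ i ∈ Finset.range n, s (W i ω) j) =
        v ⬝ᵥ fun j => (Real.sqrt n)⁻¹ * ∑ i ∈ Finset.range n, s (W i ω) j := by
      rw [dotProduct_mulVec, ← mulVec_transpose, hsymm]
    rw [h1]
    simp only [dotProduct, Finset.mul_sum]
    rw [Finset.sum_comm]
    exact Finset.sum_congr rfl fun i _ => Finset.sum_congr rfl fun j _ => by ring
  · exact (Finset.aemeasurable_fun_sum _ fun i _ => hf.comp_aemeasurable (hWm i)).const_mul _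

end GOAL

namespace GOAL

/-! ### Consequences of a correctly specified propensity score. -/

section PropensityScore

variable {Ω : Type*} {m mΩ : MeasurableSpace Ω} {P : Measure Ω} [IsProbabilityMeasure P]
  {A g f : Ω → ℝ}

lemma indicator_one_eq_of_binary (hbin : ∀ ω, A ω = 0 ∨ A ω = 1) :
    (A ⁻¹' {1}).indicator (fun _ => (1 : ℝ)) = A := by
  ext ω
  rcases hbin ω with h | h <;> simp [h]

/-- A binary variable may be replaced by its conditional probability under the integral. -/
lemma integral_mul_eq_of_condExp (hm : m ≤ mΩ) (hbin : ∀ ω, A ω = 0 ∨ A ω = 1)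
    (hA : Measurable A) (hcond : P⟦A ⁻¹' {1} | m⟧ =ᵐ[P] g)
    (hf : StronglyMeasurable[m] f) (hint : Integrable f P) :
    ∫ ω, A ω * f ω ∂P = ∫ ω, g ω * f ω ∂P := by
  have hb : ∀ ω, ‖A ω‖ ≤ 1 := fun ω => by rcases hbin ω with h | h <;> simp [h]
  have hAint : Integrable A P :=
    Integrable.of_bound hA.aestronglyMeasurable 1 (Eventually.of_forall hb)
  have hAf : Integrable (A * f) P :=
    hint.bdd_mul hA.aestronglyMeasurable (Eventually.of_forall hb)
  rw [indicator_one_eq_of_binary hbin] at hcond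
  have h := condExp_mul_of_stronglyMeasurable_right hf hAf hAint
  calc ∫ ω, A ω * f ω ∂P = ∫ ω, (P[A * f | m]) ω ∂P := (integral_condExp hm).symm
    _ = ∫ ω, g ω * f ω ∂P := integral_congr_ae <| by
        filter_upwards [h, hcond] with ω h1 h2
        rw [h1, Pi.mul_apply, h2]

/-- A binary variable whose conditional probability lies strictly between zero and one is not
determined by the conditioning. -/
lemma not_ae_eq_of_condExp_mem_Ioo (hm : m ≤ mΩ) (hbin : ∀ ω, A ω = 0 ∨ A ω = 1)
    (hA : Measurable A) (hcond : P⟦A ⁻¹' {1} | m⟧ =ᵐ[P] g)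
    (hg : ∀ ω, 0 < g ω ∧ g ω < 1) (hf : StronglyMeasurable[m] f) : ¬ A =ᵐ[P] f := by
  intro h
  have hAint : Integrable A P := Integrable.of_bound hA.aestronglyMeasurable 1
    (Eventually.of_forall fun ω => by rcases hbin ω with h | h <;> simp [h])
  rw [indicator_one_eq_of_binary hbin] at hcond
  -- If A were a.e. equal to the m-measurable `f`, its conditional probability `g` would equal A,
  -- hence take only the values 0 and 1.
  have h1 : P[A | m] =ᵐ[P] P[f | m] := condExp_congr_ae h
  rw [condExp_of_stronglyMeasurable hm hf (hAint.congr h)] at h1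
  have h2 : ∀ᵐ _ω ∂P, False := by
    filter_upwards [h, h1, hcond] with ω e1 e2 e3
    have := hg ω
    rcases hbin ω with h0 | h0 <;> rw [← e3, e2, ← e1, h0] at this <;> linarith [this.1, this.2]
  simp at h2
  exact IsProbabilityMeasure.ne_zero P h2

variable {ι : Type*} [Fintype ι] {x : Ω → ι → ℝ} {θ : ι → ℝ}

/-- The score of a correctly specified logistic model is centred. -/
lemma integral_score_eq_zero (hm : m ≤ mΩ) (hbin : ∀ ω, A ω = 0 ∨ A ω = 1)
    (hA : Measurable A) (hcond : P⟦A ⁻¹' {1} | m⟧ =ᵐ[P] fun ω => Real.sigmoid (x ω ⬝ᵥ θ))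
    (hx : ∀ j, Measurable[m] fun ω => x ω j) (hx2 : ∀ j, MemLp (fun ω => x ω j) 2 P) (j : ι) :
    ∫ ω, (A ω - Real.sigmoid (x ω ⬝ᵥ θ)) * x ω j ∂P = 0 := by
  have hint := (hx2 j).integrable one_le_two
  have hσ : Measurable fun ω => Real.sigmoid (x ω ⬝ᵥ θ) :=
    continuous_sigmoid.measurable.comp
      (Finset.measurable_sum _ fun k _ => ((hx k).mono hm le_rfl).mul_const _)
  have h := integral_mul_eq_of_condExp hm hbin hA hcond (hx j).stronglyMeasurable hint
  simp only [sub_mul]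
  rw [integral_sub, h, sub_self]
  · exact hint.bdd_mul (c := 1) hA.aestronglyMeasurable
      (Eventually.of_forall fun ω => by rcases hbin ω with h | h <;> simp [h])
  · refine hint.bdd_mul (c := 1) hσ.aestronglyMeasurable (Eventually.of_forall fun ω => ?_)
    rw [Real.norm_of_nonneg (Real.sigmoid_nonneg _)]
    exact Real.sigmoid_le_one _

/-- The information identity of a correctly specified logistic model. -/
lemma integral_score_mul_score (hm : m ≤ mΩ) (hbin : ∀ ω, A ω = 0 ∨ A ω = 1)
    (hA : Measurable A) (hcond : P⟦A ⁻¹' {1} | m⟧ =ᵐ[P] fun ω => Real.sigmoid (x ω ⬝ᵥ θ))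
    (hx : ∀ j, Measurable[m] fun ω => x ω j) (hx2 : ∀ j, MemLp (fun ω => x ω j) 2 P) (j k : ι) :
    ∫ ω, (A ω - Real.sigmoid (x ω ⬝ᵥ θ)) * x ω j * ((A ω - Real.sigmoid (x ω ⬝ᵥ θ)) * x ω k) ∂P =
      logisticInfo P x θ j k := by
  have hint : Integrable (fun ω => x ω j * x ω k) P := (hx2 j).integrable_mul (hx2 k)
  have hσm : Measurable[m] fun ω => Real.sigmoid (x ω ⬝ᵥ θ) :=
    continuous_sigmoid.measurable.comp
      (Finset.measurable_sum _ fun k _ => (hx k).mul_const _)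
  have hσ : Measurable fun ω => Real.sigmoid (x ω ⬝ᵥ θ) := hσm.mono hm le_rfl
  -- Since A² = A, (A - σ)² = A(1 - 2σ) + σ². Replacing A by σ turns this into σ(1 - σ), and the
  -- present function is the factor multiplying A.
  have hf : Measurable[m] fun ω => (1 - 2 * Real.sigmoid (x ω ⬝ᵥ θ)) * (x ω j * x ω k) :=
    ((hσm.const_mul 2).const_sub 1).mul ((hx j).mul (hx k))
  have hfint : Integrable (fun ω => (1 - 2 * Real.sigmoid (x ω ⬝ᵥ θ)) * (x ω j * x ω k)) P := by
    refine hint.bdd_mul (c := 1) ((hσ.const_mul 2).const_sub 1).aestronglyMeasurable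
      (Eventually.of_forall fun ω => ?_)
    have h0 := Real.sigmoid_nonneg (x ω ⬝ᵥ θ)
    have h1 := Real.sigmoid_le_one (x ω ⬝ᵥ θ)
    rw [Real.norm_eq_abs, abs_le]
    constructor <;> linarith
  have hb : ∀ ω, ‖Real.sigmoid (x ω ⬝ᵥ θ)‖ ≤ 1 := fun ω => by
    rw [Real.norm_of_nonneg (Real.sigmoid_nonneg _)]
    exact Real.sigmoid_le_one _
  have hsq : Integrable (fun ω => Real.sigmoid (x ω ⬝ᵥ θ) *
      (Real.sigmoid (x ω ⬝ᵥ θ) * (x ω j * x ω k))) P :=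
    (hint.bdd_mul hσ.aestronglyMeasurable (Eventually.of_forall hb)).bdd_mul
      hσ.aestronglyMeasurable (Eventually.of_forall hb)
  have h := integral_mul_eq_of_condExp hm hbin hA hcond hf.stronglyMeasurable hfint
  have hAf : Integrable (fun ω => A ω *
      ((1 - 2 * Real.sigmoid (x ω ⬝ᵥ θ)) * (x ω j * x ω k))) P :=
    hfint.bdd_mul (c := 1) hA.aestronglyMeasurable
      (Eventually.of_forall fun ω => by rcases hbin ω with h | h <;> simp [h])
  have hσf : Integrable (fun ω => Real.sigmoid (x ω ⬝ᵥ θ) *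
      ((1 - 2 * Real.sigmoid (x ω ⬝ᵥ θ)) * (x ω j * x ω k))) P :=
    hfint.bdd_mul hσ.aestronglyMeasurable (Eventually.of_forall hb)
  calc _ = ∫ ω, A ω * ((1 - 2 * Real.sigmoid (x ω ⬝ᵥ θ)) * (x ω j * x ω k)) +
        Real.sigmoid (x ω ⬝ᵥ θ) * (Real.sigmoid (x ω ⬝ᵥ θ) * (x ω j * x ω k)) ∂P := by
        refine integral_congr_ae (Eventually.of_forall fun ω => ?_)
        have hA2 : A ω * A ω = A ω := by rcases hbin ω with h | h <;> simp [h]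
        simp only
        linear_combination (x ω j * x ω k) * hA2
    _ = _ := by
        rw [integral_add hAf hsq, h, ← integral_add hσf hsq, logisticInfo, Matrix.of_apply]
        exact integral_congr_ae (Eventually.of_forall fun ω => by simp only; ring)

end PropensityScore

/-! ### Inclusion in the target set depends only on the outcome coefficient. -/

section Desirable

variable {p : ℕ} {α β : Fin p → ℝ} {j : Fin p}

lemma mem_desirable_iff : j ∈ desirable α β ↔ β j ≠ 0 := by
  simp only [desirable, confounders, outcomeOnly, Finset.mem_union, Finset.mem_filter,
    Finset.mem_univ, true_and]
  tauto

lemma mem_treatmentOnly_union_spurious_iff : j ∈ treatmentOnly α β ∪ spurious α β ↔ β j = 0 := by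
  simp only [treatmentOnly, spurious, Finset.mem_union, Finset.mem_filter,
    Finset.mem_univ, true_and]
  tauto

end Desirable

/-! ### Growth of the adaptive weights; comparison of norms. -/

section Rates

/-- With a root-`n` consistent estimate of a zero coefficient, the adaptive weight eventually
dominates any sequence of order `n`. -/
lemma eventually_lt_mul_weight {lam1 : ℕ → ℝ} {γ : ℝ} (hγ : 0 ≤ γ)
    (hlam1 : ∀ n, 0 ≤ lam1 n)
    (h : Tendsto (fun n : ℕ => lam1 n * (n : ℝ) ^ (γ / 2 - 1)) atTop atTop) (K L : ℝ) :
    ∀ᶠ n : ℕ in atTop, ∀ b S : ℝ, Real.sqrt n * |b| ≤ K → S ≤ L * n →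
      ENNReal.ofReal S < ENNReal.ofReal (lam1 n) * weight γ b := by
  -- Makes the bound positive, so that dividing by K'^γ is legitimate.
  set K' := max K 1
  have hK' : 0 < K' := lt_max_of_lt_right one_pos
  filter_upwards [h.eventually_gt_atTop (max L 0 * K' ^ γ), eventually_gt_atTop 0]
    with n hn hn0 b S hb hS
  have hn' : (0 : ℝ) < n := Nat.cast_pos.2 hn0
  have hs : 0 < Real.sqrt n := Real.sqrt_pos.2 hn'
  have hb' : |b| ≤ K' / Real.sqrt n := by
    rw [le_div_iff₀ hs, mul_comm]
    exact hb.trans (le_max_left _ _)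
  -- The weight decreases in |b|; working in `ℝ≥0∞` includes b = 0 without a separate case.
  have hw : ENNReal.ofReal ((K' / Real.sqrt n) ^ (-γ)) ≤ weight γ b := by
    rw [← ENNReal.ofReal_rpow_of_pos (by positivity), weight, ENNReal.rpow_neg, ENNReal.rpow_neg]
    exact ENNReal.inv_le_inv.2 (ENNReal.rpow_le_rpow (ENNReal.ofReal_le_ofReal hb') hγ)
  refine lt_of_lt_of_le ?_ (mul_le_mul_right hw _)
  rw [← ENNReal.ofReal_mul (hlam1 n)]
  have hkey : lam1 n * (K' / Real.sqrt n) ^ (-γ) =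
      lam1 n * (n : ℝ) ^ (γ / 2 - 1) * n / K' ^ γ := by
    have h1 : (K' / Real.sqrt n) ^ (-γ) = (n : ℝ) ^ (γ / 2) / K' ^ γ := by
      rw [Real.rpow_neg (by positivity), Real.div_rpow hK'.le hs.le, inv_div, Real.sqrt_eq_rpow,
        ← Real.rpow_mul hn'.le]
      congr 2
      ring
    have h2 : (n : ℝ) ^ (γ / 2) = (n : ℝ) ^ (γ / 2 - 1) * n := by
      rw [Real.rpow_sub_one hn'.ne', div_mul_cancel₀ _ hn'.ne']
    rw [h1, h2]
    ring
  have hlt : max L 0 * n < lam1 n * (K' / Real.sqrt n) ^ (-γ) := by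
    rw [hkey, lt_div_iff₀ (by positivity)]
    nlinarith
  have hmax : L * n ≤ max L 0 * n := mul_le_mul_of_nonneg_right (le_max_left _ _) hn'.le
  exact (ENNReal.ofReal_lt_ofReal_iff (lt_of_le_of_lt (by positivity) hlt)).2 (by linarith)

/-- Passes from the sup norm of the expansions to the Euclidean norm of the Gaussian limit. -/
lemma norm_toLp_two_le {ι : Type*} [Fintype ι] (v : ι → ℝ) :
    ‖WithLp.toLp 2 v‖ ≤ Real.sqrt (Fintype.card ι) * ‖v‖ := by
  rw [EuclideanSpace.norm_eq]
  refine Real.sqrt_le_iff.2 ⟨by positivity, ?_⟩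
  rw [mul_pow, Real.sq_sqrt (Nat.cast_nonneg _)]
  calc ∑ i, ‖v i‖ ^ 2 ≤ ∑ _i : ι, ‖v‖ ^ 2 := by
        gcongr with i _
        exact norm_le_pi_norm v i
    _ = _ := by simp

end Rates

end GOAL

/-! ### Preliminary estimates, penalty and selection in the observed model. -/

namespace GOAL

variable {p : ℕ} {Ω : Type*} [MeasurableSpace Ω] {P : Measure Ω}
  {X : ℕ → Ω → Fin p → ℝ} {A Y : ℕ → Ω → ℝ}

lemma fisherInfo_eq_logisticInfo (x : Ω → Fin p → ℝ) (α : Fin p → ℝ) :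
    fisherInfo P x α = logisticInfo P x α := by
  ext j k
  simp [fisherInfo, logisticInfo, iteratedDeriv_two_phi]

/-- Positive definite Fisher information rules out collinear covariates. -/
lemma not_ae_dotProduct_eq_zero {x : Ω → Fin p → ℝ} (hx2 : ∀ j, MemLp (fun ω => x ω j) 2 P)
    {α : Fin p → ℝ} (hF : (fisherInfo P x α).PosDef) {u : Fin p → ℝ} (hu : u ≠ 0) :
    ¬ ∀ᵐ ω ∂P, x ω ⬝ᵥ u = 0 := by
  intro h
  have h1 : 0 < u ⬝ᵥ fisherInfo P x α *ᵥ u := by simpa using hF.dotProduct_mulVec_pos hu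
  rw [fisherInfo_eq_logisticInfo, logisticInfo,
    ← integral_mul_dotProduct_sq (integrable_sigmoid_mul hx2 α)] at h1
  refine h1.ne' (integral_eq_zero_of_ae ?_)
  filter_upwards [h] with ω hω
  simp [hω]

/-- Root-n consistency keeps estimates of nonzero coefficients away from 0, so the corresponding
weights are at most (|β j| / 2)^(-γ). For zero coefficients there is nothing to prove. -/
lemma withHighProb_half_le {β : Fin p → ℝ} {b : ℕ → Ω → Fin p → ℝ}
    (hb : BoundedInProb P fun n ω => Real.sqrt n * ‖b n ω - β‖) :
    WithHighProb P fun n ω => ∀ j, |β j| / 2 ≤ |b n ω j| := by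
  refine WithHighProb.forall fun j => ?_
  by_cases hβ : β j = 0
  · refine WithHighProb.of_ae (Eventually.of_forall fun n => Eventually.of_forall fun ω => ?_)
    rw [hβ, abs_zero, zero_div]
    exact abs_nonneg _
  refine hb.withHighProb fun K => WithHighProb.of_ae ?_
  have hβ' : 0 < |β j| := abs_pos.2 hβ
  have hlim : Tendsto (fun n : ℕ => Real.sqrt n * (|β j| / 2)) atTop atTop :=
    (Real.tendsto_sqrt_atTop.comp tendsto_natCast_atTop_atTop).atTop_mul_const (by positivity)
  filter_upwards [hlim.eventually_ge_atTop K, eventually_gt_atTop 0] with n hn hn0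
  refine Eventually.of_forall fun ω hK => ?_
  have hs : 0 < Real.sqrt n := Real.sqrt_pos.2 (Nat.cast_pos.2 hn0)
  have h1 : ‖b n ω - β‖ ≤ |β j| / 2 :=
    le_of_mul_le_mul_left (((le_abs_self _).trans hK).trans hn) hs
  have h2 := (norm_le_pi_norm (b n ω - β) j).trans h1
  rw [Pi.sub_apply, Real.norm_eq_abs, abs_sub_comm] at h2
  have h3 := abs_sub_abs_le_abs_sub (β j) (b n ω j)
  linarith

/-- The penalty is locally negligible at coefficients with non-vanishing outcome effects. -/
lemma withHighProb_penalty_sub_le {s : Finset (Fin p)} {β : Fin p → ℝ} (hs : ∀ j ∈ s, β j ≠ 0)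
    {lam1 lam2 : ℕ → ℝ} {γ : ℝ} (hlam1_nonneg : ∀ n, 0 ≤ lam1 n)
    (hlam2_nonneg : ∀ n, 0 ≤ lam2 n) (hγ : 0 ≤ γ)
    (hlam1 : Tendsto (fun n : ℕ => lam1 n / Real.sqrt n) atTop (𝓝 0))
    (hlam2 : Tendsto (fun n : ℕ => lam2 n / Real.sqrt n) atTop (𝓝 0))
    {b : ℕ → Ω → Fin p → ℝ} (hb : WithHighProb P fun n ω => ∀ j, |β j| / 2 ≤ |b n ω j|)
    (θ : s → ℝ) {R η : ℝ} (hη : 0 < η) :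
    WithHighProb P fun n ω => ∀ u : s → ℝ, ‖u‖ ≤ R →
      |∑ j : s, (lam1 n * |b n ω j| ^ (-γ) * |(θ + (Real.sqrt n)⁻¹ • u) j| +
          lam2 n * (θ + (Real.sqrt n)⁻¹ • u) j ^ 2) -
        ∑ j : s, (lam1 n * |b n ω j| ^ (-γ) * |θ j| + lam2 n * θ j ^ 2)| ≤ η := by
  set C : s → ℝ := fun j => (|β j| / 2) ^ (-γ)
  have hlim : Tendsto (fun n : ℕ => ∑ j : s, (lam1 n * (Real.sqrt n)⁻¹ * (C j * R) +
      lam2 n * (Real.sqrt n)⁻¹ * (2 * |θ j| * R + R ^ 2))) atTop (𝓝 0) := by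
    have h := tendsto_finsetSum (Finset.univ : Finset s) fun j _ =>
      (hlam1.mul_const (C j * R)).add (hlam2.mul_const (2 * |θ j| * R + R ^ 2))
    simpa [div_eq_mul_inv] using h
  refine hb.mono ?_
  filter_upwards [hlim.eventually_le_const hη, eventually_gt_atTop 0] with n hn hn0 ω hω u hu
  refine (abs_elasticNet_sub_le (κ := fun j : s => lam1 n * |b n ω j| ^ (-γ)) (C := C)
    (fun j => mul_nonneg (hlam1_nonneg n) (by positivity)) (fun j => ?_) (hlam2_nonneg n)
    (by positivity) ?_ θ u hu).trans hn
  · refine mul_le_mul_of_nonneg_left ?_ (hlam1_nonneg n)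
    have := abs_pos.2 (hs j j.2)
    exact Real.rpow_le_rpow_of_nonpos (by positivity) (hω j) (by linarith)
  · exact inv_le_one_of_one_le₀ (Real.one_le_sqrt.2 (by exact_mod_cast hn0))

variable [IsProbabilityMeasure P]

/-- Root-`n` consistency of the preliminary least squares estimates. -/
lemma boundedInProb_sqrt_mul_ols (hX : ∀ i, Measurable (X i)) (hA : ∀ i, Measurable (A i))
    (hAbin : ∀ i ω, A i ω = 0 ∨ A i ω = 1)
    (hW : IsIID P fun i ω => (X i ω, A i ω, Y i ω))
    {α₀ : Fin p → ℝ}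
    (hPS : P⟦A 0 ⁻¹' {1} | MeasurableSpace.comap (X 0) inferInstance⟧
      =ᵐ[P] fun ω => Real.sigmoid (X 0 ω ⬝ᵥ α₀))
    {βA : ℝ} {β : Fin p → ℝ} {ε : Ω → ℝ}
    (hε : ∀ ω, Y 0 ω = βA * A 0 ω + X 0 ω ⬝ᵥ β + ε ω)
    (hX2 : ∀ j, MemLp (fun ω => X 0 ω j) 2 P)
    (hεA2 : MemLp (fun ω => ε ω * A 0 ω) 2 P)
    (hεX2 : ∀ j, MemLp (fun ω => ε ω * X 0 ω j) 2 P)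
    (hεA : ∫ ω, ε ω * A 0 ω ∂P = 0)
    (hεX : ∀ j, ∫ ω, ε ω * X 0 ω j ∂P = 0)
    {αs : Fin p → ℝ} (hFpos : (fisherInfo P (X 0) αs).PosDef)
    {bA : ℕ → Ω → ℝ} {b : ℕ → Ω → Fin p → ℝ}
    (hOLS : ∀ n ω, IsOLS n (fun i => X i ω) (fun i => A i ω) (fun i => Y i ω)
      (bA n ω) (b n ω)) :
    BoundedInProb P fun n ω => Real.sqrt n * ‖b n ω - β‖ := by
  -- The joint regressor (A, X), with the treatment at index `none`.
  set z : (Fin p → ℝ) × ℝ × ℝ → Option (Fin p) → ℝ := fun v o => o.elim v.2.1 v.1 with hz_def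
  have hz : Measurable z := measurable_pi_lambda _ fun o => by
    cases o <;> simp only [hz_def, Option.elim_none, Option.elim_some] <;> fun_prop
  set e : (Fin p → ℝ) × ℝ × ℝ → ℝ := fun v => v.2.2 - βA * v.2.1 - v.1 ⬝ᵥ β with he_def
  have he : Measurable e :=
    ((measurable_snd.comp measurable_snd).sub ((measurable_fst.comp measurable_snd).const_mul _)).sub
      ((measurable_dotProduct_const measurable_id β).comp measurable_fst)
  have he0 : ∀ ω, e (X 0 ω, A 0 ω, Y 0 ω) = ε ω := fun ω => by
    simp only [he_def, hε]
    ring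
  have hdot : ∀ (v : (Fin p → ℝ) × ℝ × ℝ) (d : Option (Fin p) → ℝ),
      z v ⬝ᵥ d = v.2.1 * d none + v.1 ⬝ᵥ fun j => d (some j) := fun v d => by
    simp [dotProduct, hz_def, Fintype.sum_option]
  have hA2 : MemLp (A 0) 2 P := MemLp.of_bound (hA 0).aestronglyMeasurable 1
    (Eventually.of_forall fun ω => by rcases hAbin 0 ω with h | h <;> simp [h])
  have hz2 : ∀ o, MemLp (fun ω => z (X 0 ω, A 0 ω, Y 0 ω) o) 2 P := fun o => by
    cases o with
    | none => exact hA2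
    | some j => exact hX2 j
  set d : ℕ → Ω → Option (Fin p) → ℝ := fun n ω o => o.elim (bA n ω - βA) (b n ω - β) with hd_def
  have hpos : ∀ u : Option (Fin p) → ℝ, u ≠ 0 →
      0 < ∫ ω, (z (X 0 ω, A 0 ω, Y 0 ω) ⬝ᵥ u) ^ 2 ∂P := fun u hu => by
    have hint : Integrable (fun ω => (z (X 0 ω, A 0 ω, Y 0 ω) ⬝ᵥ u) ^ 2) P := by
      have hint := integrable_mul_dotProduct_sq (P := P) (w := fun _ => (1 : ℝ))
        (z := fun ω => z (X 0 ω, A 0 ω, Y 0 ω))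
        (fun j k => by simpa using! (hz2 j).integrable_mul (hz2 k)) u
      simpa only [one_mul] using hint
    refine lt_of_le_of_ne (integral_nonneg fun ω => sq_nonneg _) fun h0 => ?_
    have hae := (integral_eq_zero_iff_of_nonneg (fun ω => sq_nonneg _) hint).1 h0.symm
    -- A vanishing second moment makes the linear form zero a.e. Without the treatment this is
    -- collinearity of the covariates; with it, A would be a linear function of them.
    by_cases hu0 : u none = 0
    · refine not_ae_dotProduct_eq_zero hX2 hFpos (u := fun j => u (some j)) ?_ ?_
      · intro h
        refine hu (funext fun o => ?_)
        cases o with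
        | none => exact hu0
        | some j => exact congrFun h j
      · filter_upwards [hae] with ω hω
        have h1 := pow_eq_zero_iff two_ne_zero |>.1 hω
        rwa [hdot, hu0, mul_zero, zero_add] at h1
    · refine not_ae_eq_of_condExp_mem_Ioo (hX 0).comap_le (hAbin 0) (hA 0) hPS
        (fun ω => ⟨Real.sigmoid_pos _, Real.sigmoid_lt_one _⟩)
        (f := fun ω => -(X 0 ω ⬝ᵥ fun j => u (some j)) / u none) ?_ ?_
      · exact ((((measurable_dotProduct_const measurable_id _).comp
          (comap_measurable (X 0))).neg).div_const _).stronglyMeasurable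
      · filter_upwards [hae] with ω hω
        have h1 := pow_eq_zero_iff two_ne_zero |>.1 hω
        rw [hdot] at h1
        rw [eq_div_iff hu0]
        linarith
  have hmain := hW.boundedInProb_leastSquares hz he hz2
    (fun o => by
      simp only [he0]
      cases o with
      | none => exact hεA2
      | some j => exact hεX2 j)
    (fun o => by
      simp only [he0]
      cases o with
      | none => exact hεA
      | some j => exact hεX j) hpos (d := d) (fun n ω => by
        have h := hOLS n ω βA β
        refine le_trans (le_of_eq ?_) h
        refine Finset.sum_congr rfl fun i _ => ?_
        have h1 : (fun j => d n ω (some j)) = b n ω - β := rfl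
        rw [hdot, h1, dotProduct_sub]
        simp only [he_def, hd_def, Option.elim_none]
        ring)
  refine hmain.of_abs_le zero_le_one (WithHighProb.of_ae
    (Eventually.of_forall fun n => Eventually.of_forall fun ω => ?_))
  rw [one_mul, abs_of_nonneg (by positivity), abs_of_nonneg (by positivity)]
  refine mul_le_mul_of_nonneg_left ?_ (Real.sqrt_nonneg _)
  exact (pi_norm_le_iff_of_nonneg (norm_nonneg _)).2 fun j => norm_le_pi_norm (d n ω) (some j)

/-- With high probability the covariates unrelated to the outcome are not selected. -/
lemma withHighProb_eq_zero (hAbin : ∀ i ω, A i ω = 0 ∨ A i ω = 1)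
    (hW : IsIID P X) (hX2 : ∀ j, MemLp (fun ω => X 0 ω j) 2 P)
    {β : Fin p → ℝ} {lam1 lam2 : ℕ → ℝ} {γ : ℝ} (hlam1_nonneg : ∀ n, 0 ≤ lam1 n)
    (hlam2_nonneg : ∀ n, 0 ≤ lam2 n) (hγ : 0 ≤ γ)
    (hlam1' : Tendsto (fun n : ℕ => lam1 n * (n : ℝ) ^ (γ / 2 - 1)) atTop atTop)
    {b : ℕ → Ω → Fin p → ℝ} (hb : BoundedInProb P fun n ω => Real.sqrt n * ‖b n ω - β‖)
    {αhat : ℕ → Ω → Fin p → ℝ}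
    (hαhat : ∀ᶠ n in atTop, ∀ᵐ ω ∂P, IsGOAL n (fun i => X i ω) (fun i => A i ω)
      (lam1 n) (lam2 n) γ (b n ω) (αhat n ω)) :
    WithHighProb P fun n ω => ∀ j, β j = 0 → αhat n ω j = 0 := by
  refine WithHighProb.forall fun j => ?_
  refine hb.withHighProb fun K => ?_
  -- Bounds Σ_i |x_ij| by L n, the order that λ₁ times the weight must exceed.
  have hN := hW.boundedInProb_average (f := fun x => |x j|) (by fun_prop)
    ((hX2 j).integrable one_le_two).abs fun _ => abs_nonneg _
  refine hN.withHighProb fun L => WithHighProb.of_ae ?_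
  filter_upwards [hαhat, eventually_lt_mul_weight hγ hlam1_nonneg hlam1' K L,
    eventually_gt_atTop 0] with n hn hlt hn0
  filter_upwards [hn] with ω hω hL hK hβ
  refine hω.eq_zero_of_sum_lt_weight (hAbin · ω) (hlam2_nonneg n) (hlt _ _ ?_ ?_)
  · refine le_trans (mul_le_mul_of_nonneg_left ?_ (Real.sqrt_nonneg _)) ((le_abs_self _).trans hK)
    have h := norm_le_pi_norm (b n ω - β) j
    rwa [Pi.sub_apply, hβ, sub_zero] at h
  · have h := (le_abs_self _).trans hL
    rwa [inv_mul_le_iff₀ (Nat.cast_pos.2 hn0), mul_comm] at h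

end GOAL

/-! ### Assembly: selection consistency and asymptotic normality. -/

theorem theorem1 {p : ℕ} {Ω : Type*} [MeasurableSpace Ω] (P : Measure Ω) [IsProbabilityMeasure P]
    -- the data: an i.i.d. sequence of (covariates, binary treatment, outcome)
    (X : ℕ → Ω → Fin p → ℝ) (A Y : ℕ → Ω → ℝ)
    (hX : ∀ i, Measurable (X i)) (hA : ∀ i, Measurable (A i)) (hY : ∀ i, Measurable (Y i))
    (hAbin : ∀ i ω, A i ω = 0 ∨ A i ω = 1)
    (hindep : iIndepFun (fun i ω => (X i ω, A i ω, Y i ω)) P)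
    (hident : ∀ i, IdentDistrib (fun ω => (X i ω, A i ω, Y i ω))
      (fun ω => (X 0 ω, A 0 ω, Y 0 ω)) P P)
    -- logistic propensity score given all covariates
    (α₀ : Fin p → ℝ)
    (hPS : P⟦A 0 ⁻¹' {1} | MeasurableSpace.comap (X 0) inferInstance⟧
      =ᵐ[P] fun ω => Real.sigmoid (X 0 ω ⬝ᵥ α₀))
    -- linear regression of the outcome on treatment and covariates, square-integrable scores
    (βA : ℝ) (β : Fin p → ℝ) (ε : Ω → ℝ)
    (hε : ∀ ω, Y 0 ω = βA * A 0 ω + X 0 ω ⬝ᵥ β + ε ω)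
    (hX2 : ∀ j, MemLp (fun ω => X 0 ω j) 2 P)
    (hεA2 : MemLp (fun ω => ε ω * A 0 ω) 2 P)
    (hεX2 : ∀ j, MemLp (fun ω => ε ω * X 0 ω j) 2 P)
    (hεA : ∫ ω, ε ω * A 0 ω ∂P = 0)
    (hεX : ∀ j, ∫ ω, ε ω * X 0 ω j ∂P = 0)
    -- the parsimonious logistic propensity score, on the covariates to include
    (αs : Fin p → ℝ) (hαs : ∀ j, j ∉ GOAL.desirable α₀ β → αs j = 0)
    (hparsPS : P⟦A 0 ⁻¹' {1} |
        MeasurableSpace.comap (fun ω (j : GOAL.desirable α₀ β) => X 0 ω j) inferInstance⟧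
      =ᵐ[P] fun ω => Real.sigmoid (X 0 ω ⬝ᵥ αs))
    -- finite and positive definite Fisher information
    (hFfin : ∀ j k, Integrable
      (fun ω => iteratedDeriv 2 GOAL.phi (X 0 ω ⬝ᵥ αs) * (X 0 ω j * X 0 ω k)) P)
    (hFpos : (GOAL.fisherInfo P (X 0) αs).PosDef)
    -- bounds on the derivatives of `φ` near `αs`
    (hbound : ∃ M₁ M₂ : (Fin p → ℝ) → ℝ,
      (∀ᶠ α in 𝓝 αs, ∀ x : Fin p → ℝ,
        |iteratedDeriv 2 GOAL.phi (x ⬝ᵥ α)| ≤ M₁ x ∧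
        |iteratedDeriv 3 GOAL.phi (x ⬝ᵥ α)| ≤ M₂ x) ∧
      Integrable (fun ω => M₁ (X 0 ω)) P ∧
      ∀ j k l, j ∈ GOAL.desirable α₀ β → k ∈ GOAL.desirable α₀ β → l ∈ GOAL.desirable α₀ β →
        Integrable (fun ω => M₂ (X 0 ω) * |X 0 ω j * X 0 ω k * X 0 ω l|) P)
    -- tuning parameters
    (lam1 lam2 : ℕ → ℝ) (γ : ℝ) (hlam1_nonneg : ∀ n, 0 ≤ lam1 n) (hlam2_nonneg : ∀ n, 0 ≤ lam2 n)
    (hγ : 1 < γ)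
    (hlam1 : Tendsto (fun n : ℕ => lam1 n / Real.sqrt n) atTop (𝓝 0))
    (hlam1' : Tendsto (fun n : ℕ => lam1 n * (n : ℝ) ^ (γ / 2 - 1)) atTop atTop)
    (hlam2 : Tendsto (fun n : ℕ => lam2 n / Real.sqrt n) atTop (𝓝 0))
    -- ordinary least squares estimates
    (bA : ℕ → Ω → ℝ) (b : ℕ → Ω → Fin p → ℝ)
    (hOLS : ∀ n ω, GOAL.IsOLS n (fun i => X i ω) (fun i => A i ω) (fun i => Y i ω)
      (bA n ω) (b n ω))
    -- the GOAL estimator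
    (αhat : ℕ → Ω → Fin p → ℝ) (hαhat_meas : ∀ n, Measurable (αhat n))
    (hαhat : ∀ᶠ n in atTop, ∀ᵐ ω ∂P, GOAL.IsGOAL n (fun i => X i ω) (fun i => A i ω)
      (lam1 n) (lam2 n) γ (b n ω) (αhat n ω)) :
    Tendsto (fun n => P {ω | ∀ j ∈ GOAL.treatmentOnly α₀ β ∪ GOAL.spurious α₀ β,
      αhat n ω j = 0}) atTop (𝓝 1) ∧
    TendstoInDistribution
      (fun (n : ℕ) ω => WithLp.toLp 2
        (fun j : GOAL.desirable α₀ β => Real.sqrt n * (αhat n ω j - αs j)))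
      atTop id (fun _ => P)
      (multivariateGaussian (0 : EuclideanSpace ℝ (GOAL.desirable α₀ β))
        (GOAL.block (GOAL.desirable α₀ β) (GOAL.fisherInfo P (X 0) αs))⁻¹) := by
  have hWW : GOAL.IsIID P fun i ω => (X i ω, A i ω, Y i ω) := ⟨hindep, hident⟩
  have hWX : GOAL.IsIID P X :=
    ⟨hindep.comp (fun _ v => v.1) fun _ => measurable_fst, fun i => (hident i).comp measurable_fst⟩
  have hγ0 : 0 ≤ γ := zero_le_one.trans hγ.le
  have hb := GOAL.boundedInProb_sqrt_mul_ols hX hA hAbin hWW hPS hε hX2 hεA2 hεX2 hεA hεX hFpos hOLS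
  have hzero := GOAL.withHighProb_eq_zero hAbin hWX hX2 hlam1_nonneg hlam2_nonneg hγ0 hlam1' hb
    hαhat
  have hhalf := GOAL.withHighProb_half_le hb
  refine ⟨?_, ?_⟩
  -- `hzero` controls the outer measure of the failure event; measurability is needed to pass to its
  -- complement.
  · have hmeas : ∀ n, MeasurableSet {ω | ∀ j ∈ GOAL.treatmentOnly α₀ β ∪ GOAL.spurious α₀ β,
        αhat n ω j = 0} := fun n => by
      simp only [Set.ofPred_forall]
      refine MeasurableSet.iInter fun j => MeasurableSet.iInter fun _ => ?_
      exact measurableSet_eq_fun ((measurable_pi_apply j).comp (hαhat_meas n)) measurable_const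
    have h1 := ENNReal.Tendsto.sub (tendsto_const_nhds (x := (1 : ℝ≥0∞))) hzero
      (Or.inl ENNReal.one_ne_top)
    rw [tsub_zero] at h1
    refine h1.congr fun n => ?_
    have h2 : {ω | ¬ ∀ j, β j = 0 → αhat n ω j = 0} =
        {ω | ∀ j ∈ GOAL.treatmentOnly α₀ β ∪ GOAL.spurious α₀ β, αhat n ω j = 0}ᶜ := by
      ext ω
      simp only [GOAL.mem_treatmentOnly_union_spurious_iff, Set.mem_compl_iff, Set.mem_ofPred_eq]
    rw [h2, prob_compl_eq_one_sub (hmeas n), ENNReal.sub_sub_cancel ENNReal.one_ne_top prob_le_one]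
  set s := GOAL.desirable α₀ β with hs_def
  have hs : ∀ j ∈ s, β j ≠ 0 := fun j hj => GOAL.mem_desirable_iff.1 hj
  -- Reduction to the parsimonious model: `αs` vanishes off `s`, so its linear predictor involves
  -- only these covariates.
  set x : (Fin p → ℝ) × ℝ × ℝ → s → ℝ := fun v j => v.1 j with hx_def
  set θ : s → ℝ := fun j => αs j with hθ_def
  have hx : Measurable x := by fun_prop
  have hxθ : ∀ v, x v ⬝ᵥ θ = v.1 ⬝ᵥ αs := fun v => by
    rw [← GOAL.extend_restrict hαs, GOAL.dotProduct_extend]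
  have hx2 : ∀ j : s, MemLp (fun ω => X 0 ω j) 2 P := fun j => hX2 j
  have hXs : Measurable fun ω (j : s) => X 0 ω j :=
    measurable_pi_lambda _ fun j => (measurable_pi_apply _).comp (hX 0)
  have hm := hXs.comap_le
  have hxm : ∀ j : s, Measurable[MeasurableSpace.comap (fun ω (j : s) => X 0 ω j) inferInstance]
      fun ω => X 0 ω j := fun j =>
    (measurable_pi_apply j).comp (comap_measurable fun ω (j : s) => X 0 ω j)
  have hcond : P⟦A 0 ⁻¹' {1} | MeasurableSpace.comap (fun ω (j : s) => X 0 ω j) inferInstance⟧ =ᵐ[P]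
      fun ω => Real.sigmoid (x (X 0 ω, A 0 ω, Y 0 ω) ⬝ᵥ θ) := by
    simpa only [hxθ] using hparsPS
  have hinfo : GOAL.logisticInfo P (fun ω => x (X 0 ω, A 0 ω, Y 0 ω)) θ =
      GOAL.block s (GOAL.fisherInfo P (X 0) αs) := by
    ext j k
    simp only [GOAL.logisticInfo, GOAL.block, GOAL.fisherInfo, hxθ, Matrix.submatrix_apply,
      Matrix.of_apply, GOAL.iteratedDeriv_two_phi]
    rfl
  have hpd : (GOAL.logisticInfo P (fun ω => x (X 0 ω, A 0 ω, Y 0 ω)) θ).PosDef := by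
    rw [hinfo]
    exact hFpos.submatrix Subtype.val_injective
  have hσ : Measurable fun v => Real.sigmoid (x v ⬝ᵥ θ) :=
    continuous_sigmoid.measurable.comp (GOAL.measurable_dotProduct_const hx θ)
  set sc : (Fin p → ℝ) × ℝ × ℝ → s → ℝ :=
    fun v j => (v.2.1 - Real.sigmoid (x v ⬝ᵥ θ)) * x v j with hsc_def
  have hsc : Measurable sc := measurable_pi_lambda _ fun j => by fun_prop
  have hWm : Measurable fun ω => (X 0 ω, A 0 ω, Y 0 ω) := (hX 0).prodMk ((hA 0).prodMk (hY 0))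
  have hsc2 : ∀ j : s, MemLp (fun ω => sc (X 0 ω, A 0 ω, Y 0 ω) j) 2 P := fun j => by
    refine (hx2 j).mono (((measurable_pi_apply j).comp hsc).comp hWm).aestronglyMeasurable
      (Eventually.of_forall fun ω => ?_)
    simp only [hsc_def, norm_mul]
    refine mul_le_of_le_one_left (norm_nonneg _) ?_
    have h0 := Real.sigmoid_nonneg (x (X 0 ω, A 0 ω, Y 0 ω) ⬝ᵥ θ)
    have h1 := Real.sigmoid_le_one (x (X 0 ω, A 0 ω, Y 0 ω) ⬝ᵥ θ)
    rw [Real.norm_eq_abs, abs_le]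
    rcases hAbin 0 ω with h | h <;> rw [h] <;> constructor <;> linarith
  have hsc0 := GOAL.integral_score_eq_zero hm (hAbin 0) (hA 0) hcond hxm hx2
  have hsccov := GOAL.integral_score_mul_score hm (hAbin 0) (hA 0) hcond hxm hx2
  -- On the likely event the excluded coefficients are exactly zero and the weights on `s` are
  -- finite, so the restricted estimator solves the smaller convex problem.
  have hmin : GOAL.WithHighProb P fun n ω =>
      ConvexOn ℝ Set.univ (fun θ' : s → ℝ =>
        ∑ j : s, (lam1 n * |b n ω j| ^ (-γ) * |θ' j| + lam2 n * θ' j ^ 2)) ∧ ∀ θ' : s → ℝ,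
      ∑ i ∈ Finset.range n, GOAL.logisticLoss (A i ω)
          (x (X i ω, A i ω, Y i ω) ⬝ᵥ fun j : s => αhat n ω j) +
        ∑ j : s, (lam1 n * |b n ω j| ^ (-γ) * |αhat n ω j| + lam2 n * αhat n ω j ^ 2) ≤
      ∑ i ∈ Finset.range n, GOAL.logisticLoss (A i ω) (x (X i ω, A i ω, Y i ω) ⬝ᵥ θ') +
        ∑ j : s, (lam1 n * |b n ω j| ^ (-γ) * |θ' j| + lam2 n * θ' j ^ 2) := by
    refine (hzero.and hhalf).mono_ae ?_
    filter_upwards [hαhat] with n hn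
    filter_upwards [hn] with ω hω ⟨h1, h2⟩
    refine ⟨GOAL.convexOn_elasticNet (fun j => mul_nonneg (hlam1_nonneg n) (by positivity))
      (hlam2_nonneg n), fun θ' => ?_⟩
    refine hω.isMin_restrict (hlam1_nonneg n) (fun j hj => ?_) (fun j hj => h1 j ?_) θ'
    · have h3 := abs_pos.2 (hs j hj)
      have h4 := h2 j
      exact abs_pos.1 (by linarith)
    · by_contra hc
      exact hj (GOAL.mem_desirable_iff.2 hc)
  have hlin := fun δ (hδ : (0 : ℝ) < δ) => hWW.penalized_logistic_asymptotically_linear hx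
    (a := fun v => v.2.1) (by fun_prop) hx2 θ hsc2 hsc0 hpd
    (pen := fun n ω θ' => ∑ j : s, (lam1 n * |b n ω j| ^ (-γ) * |θ' j| + lam2 n * θ' j ^ 2))
    (est := fun n ω j => αhat n ω j) hmin
    (fun R η _ hη => GOAL.withHighProb_penalty_sub_le hs hlam1_nonneg hlam2_nonneg hγ0 hlam1 hlam2
      hhalf θ hη) hδ
  have hclt := hWW.tendstoInDistribution_inv_mulVec hsc hsc2 hsc0 hpd hsccov
  rw [← hinfo]
  -- Slutsky: the scaled estimation error and M⁻¹V differ by a term vanishing in probability.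
  refine tendstoInDistribution_of_tendstoInMeasure_sub _ _ hclt ?_ fun n => ?_
  · rw [tendstoInMeasure_iff_norm]
    intro δ hδ
    have hpos : 0 < δ / (Real.sqrt (Fintype.card s) + 1) := by positivity
    refine tendsto_of_tendsto_of_tendsto_of_le_of_le tendsto_const_nhds (hlin _ hpos)
      (fun _ => zero_le) fun n => measure_mono fun ω hω hlt => ?_
    rw [Set.mem_ofPred_eq, Pi.sub_apply, Pi.sub_apply, Pi.zero_apply, sub_zero,
      ← WithLp.toLp_sub] at hω
    rw [lt_div_iff₀ (by positivity)] at hlt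
    refine absurd (hω.trans (GOAL.norm_toLp_two_le _)) (not_le.2 (lt_of_le_of_lt ?_ hlt))
    rw [mul_comm]
    exact mul_le_mul (le_of_eq rfl) (by linarith) (Real.sqrt_nonneg _) (norm_nonneg _)
  · refine (WithLp.measurable_toLp 2 _).comp_aemeasurable (Measurable.aemeasurable ?_)
    exact measurable_pi_lambda _ fun j =>
      (((measurable_pi_apply _).comp (hαhat_meas n)).sub_const _).const_mul _
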